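/- **Setting.** Let $K,M\ge 1$ and $\xi\in(0,1)^M$. A *bandit model* $\nu$ consists of $K$ probability distributions $\mathcal D_1,\dots,\mathcal D_K$ on $[0,1]^M$; $\mu_i^{(m)}$ is the mean of the $m$-th coordinate under $\mathcal D_i$. Arm $i$ is *$\epsilon$-good* if $\mu_i^{(m)}\ge \xi_m-\epsilon$ for all $m\in[M]$, and *good* if it is $0$-good; $[K]_{\rm good}$ is the set of good arms. A (possibly randomized) algorithm chooses in each round an arm and observes an independent reward vector drawn from the distribution of that arm; after a random number $T_{\rm stop}\in\{0,1,2,\dots\}\cup\{\infty\}$ of rounds, decided on the basis of the past only, it stops and outputs an element of $[K]\cup\{\bot\}$. For a set $\mathcal C$ of bandit models, the algorithm is *$(\delta,\epsilon)$-successful on $\mathcal C$* if for every model in $\mathcal C$: when a good arm exists, it stops and outputs an $\epsilon$-good arm with probability at least $1-\delta$; when no $\epsilon$-good arm exists, it stops and outputs $\bot$ with probability at least $1-\delta$. A *Bernoulli model* is one in which, for each arm, the coordinates of the reward vector are independent Bernoulli variables. Let $$d(x,y)=x\ln\frac xy+(1-x)\ln\frac{1-x}{1-y}\qquad(0\ln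 0=0).$$ **Theorem.** Below, $\mathcal C$ ranges over the sets of bandit models that contain every Bernoulli model with $\mu_i^{(m)}\ne\xi_m$ for all $i,m$, and $\delta$ over $(0,1)$. 1. For every $\mathcal C$ and $\delta$, every Bernoulli model in $\mathcal C$ that has a good arm, and every algorithm that is $(\delta,0)$-successful on $\mathcal C$, the expectation under that model satisfies $$\mathbb E[T_{\rm stop}]\ \ge\ \frac{\ln\frac1{2\delta}-\delta}{\max_{i\in[K]_{\rm good}}\min_{m\in[M]} d(\mu_i^{(m)},\xi_m)} .$$ 2. There exists a Bernoulli model without a good arm, with $\mu_i^{(m)}\neq\xi_m$ for all $i,m$, such that for every $\mathcal C$ and $\delta$ and every algorithm that is $(\delta,0)$-successful on $\mathcal C$, the expectation under that model satisfies $$\mathbb E[T_{\rm stop}]\ \ge\ \frac{\ln\frac1{2\delta}-\delta}{\max_{i\in[K]}\min_{m\in[M]} d(\mu_i^{(m)},\xi_m)} .$$ Moreover, for every $c>0$ this model can be chosen with $0<\max_{i\in[K]}\min_{m\in[M]} d(\mu_i^{(m)},\xi_m)\le c$. (If the denominator is $0$, the right-hand side is read as $+\infty$ when the numerator is positive, and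 as $0$ otherwise.) -/

import Mathlib

open MeasureTheory ProbabilityTheory
open scoped ENNReal unitInterval

noncomputable section

namespace MTGAI

/-- The binary relative entropy `d(x, y)`. The terms with `x = 0` or `x = 1` follow the usual
convention `0 ln 0 = 0`, and `d(0, 0) = d(1, 1) = 0`. -/
def binRelEntropy (x y : ℝ) : ℝ :=
  x * Real.log (x / y) + (1 - x) * Real.log ((1 - x) / (1 - y))

/-- A bandit model with `K` arms and `M` objectives: for each arm a probability distribution of
the reward vector, concentrated on `[0,1]^M`. (The coordinates are then automatically
`(mean, 1/2)`-subgaussian, by Hoeffding's lemma; a further restriction of the admissible models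
is expressed by a set of models.) -/
structure BanditModel (K M : ℕ) where
  law : Fin K → Measure (Fin M → ℝ)
  isProb : ∀ i, IsProbabilityMeasure (law i)
  mem_Icc : ∀ i, ∀ᵐ z ∂(law i), ∀ m, z m ∈ Set.Icc (0 : ℝ) 1

attribute [instance] BanditModel.isProb

namespace BanditModel

variable {K M : ℕ}

/-- The mean `μ_i^{(m)}` of objective `m` under arm `i`. -/
def mean (ν : BanditModel K M) (i : Fin K) (m : Fin M) : ℝ := ∫ z, z m ∂(ν.law i)

/-- Arm `i` is `ε`-good for the thresholds `ξ`. -/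
def IsGood (ν : BanditModel K M) (ξ : Fin M → ℝ) (ε : ℝ) (i : Fin K) : Prop :=
  ∀ m, ξ m - ε ≤ ν.mean i m

/-- `max_{i ∈ S} min_m d(μ_i^{(m)}, ξ_m)`, as an element of `[0, ∞]`. -/
def maxMinEntropy (ν : BanditModel K M) (ξ : Fin M → ℝ) (S : Set (Fin K)) : ℝ≥0∞ :=
  ⨆ i ∈ S, ⨅ m, ENNReal.ofReal (binRelEntropy (ν.mean i m) (ξ m))

/-- The Bernoulli bandit model with means `p`: the coordinates of the reward vector of arm `i` are
independent, and the `m`-th one is `1` with probability `p i m` and `0` otherwise. -/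
def bernoulli (p : Fin K → Fin M → I) : BanditModel K M where
  law i := Measure.pi fun m => bernoulliMeasure (1 : ℝ) 0 (p i m)
  isProb i := inferInstance
  mem_Icc i := by
    rw [ae_all_iff]
    intro m
    have h : ∀ᵐ x ∂(bernoulliMeasure (1 : ℝ) 0 (p i m)), x ∈ Set.Icc (0 : ℝ) 1 := by
      rw [ae_iff]
      have hs : MeasurableSet {x : ℝ | ¬ x ∈ Set.Icc (0 : ℝ) 1} := measurableSet_Icc.compl
      exact bernoulliMeasure_apply_of_notMem_of_notMem _ hs (by simp) (by simp)
    exact (Measure.tendsto_eval_ae_ae (μ := fun m => bernoulliMeasure (1 : ℝ) 0 (p i m))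
      (i := m)).eventually h

/-- The Bernoulli bandit models none of whose means is equal to the threshold that it is compared
with. -/
def nondegenerateBernoulli (K : ℕ) (ξ : Fin M → ℝ) : Set (BanditModel K M) :=
  {ν | ∃ q : Fin K → Fin M → I, (∀ i m, (q i m : ℝ) ≠ ξ m) ∧ ν = bernoulli q}

end BanditModel

/-- What a player has seen after `t` rounds: the arms chosen and the reward vectors returned. -/
abbrev History (K M t : ℕ) : Type := Fin t → Fin K × (Fin M → ℝ)

/-- A (possibly randomized) algorithm: internal randomness, drawn once and for all, a sampling
rule (the arm chosen after `t` rounds), a stopping rule (whether to stop after `t` rounds), and a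
recommendation rule (the answer when stopping after `t` rounds; `none` stands for `⊥`). All three
depend on the internal randomness and on the history only. -/
structure Algorithm (K M : ℕ) where
  Seed : Type
  [measurableSpaceSeed : MeasurableSpace Seed]
  seedLaw : Measure Seed
  [isProb : IsProbabilityMeasure seedLaw]
  sample : (t : ℕ) → Seed × History K M t → Fin K
  stopSet : (t : ℕ) → Set (Seed × History K M t)
  recommend : (t : ℕ) → Seed × History K M t → Option (Fin K)
  measurable_sample : ∀ t, Measurable (sample t)
  measurableSet_stopSet : ∀ t, MeasurableSet (stopSet t)
  measurableSet_recommend : ∀ t o, MeasurableSet (recommend t ⁻¹' {o})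

attribute [instance] Algorithm.measurableSpaceSeed Algorithm.isProb

namespace Algorithm

variable {K M : ℕ}

/-- An outcome: the internal randomness and the reward vectors `z t i` that Nature returns if arm
`i` is chosen in the round that follows `t` completed rounds. -/
abbrev Outcome (A : Algorithm K M) : Type := A.Seed × (ℕ → Fin K → Fin M → ℝ)

/-- The law of the outcome under the model `ν`: all reward vectors are independent, independent of
the internal randomness, and distributed according to their arm. -/
def outcomeLaw (A : Algorithm K M) (ν : BanditModel K M) : Measure A.Outcome :=
  A.seedLaw.prod (Measure.infinitePi fun _ : ℕ => Measure.pi ν.law)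

/-- The history of the first `t` rounds (were the player not to stop earlier): only the reward
vector of the arm chosen is seen. -/
def history (A : Algorithm K M) (ω : A.Outcome) : (t : ℕ) → History K M t
  | 0 => Fin.elim0
  | t + 1 =>
    Fin.snoc (α := fun _ => Fin K × (Fin M → ℝ)) (A.history ω t)
      (A.sample t (ω.1, A.history ω t), ω.2 t (A.sample t (ω.1, A.history ω t)))

/-- The number of rounds after which the algorithm first stops; `⊤` if it never does. -/
def stoppingTime (A : Algorithm K M) (ω : A.Outcome) : ℕ∞ :=
  ⨅ (t : ℕ) (_ : (ω.1, A.history ω t) ∈ A.stopSet t), (t : ℕ∞)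

/-- The algorithm stops and its output is `o`. -/
def Outputs (A : Algorithm K M) (ω : A.Outcome) (o : Option (Fin K)) : Prop :=
  ∃ t : ℕ, A.stoppingTime ω = t ∧ A.recommend t (ω.1, A.history ω t) = o

/-- `E_ν[T_stop]`, an element of `[0, ∞]`. -/
def expectedStoppingTime (A : Algorithm K M) (ν : BanditModel K M) : ℝ≥0∞ :=
  ∫⁻ ω, (A.stoppingTime ω : ℝ≥0∞) ∂(A.outcomeLaw ν)

/-- The algorithm is `(δ, ε)`-successful for the thresholds `ξ` on the class `C` of models. -/
def IsSuccessful (A : Algorithm K M) (C : Set (BanditModel K M)) (ξ : Fin M → ℝ) (δ ε : ℝ) :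
    Prop :=
  ∀ ν ∈ C,
    ((∃ i, ν.IsGood ξ 0 i) →
      1 - δ ≤ (A.outcomeLaw ν).real {ω | ∃ i, A.Outputs ω (some i) ∧ ν.IsGood ξ ε i}) ∧
    ((¬ ∃ i, ν.IsGood ξ ε i) →
      1 - δ ≤ (A.outcomeLaw ν).real {ω | A.Outputs ω none})

end Algorithm

end MTGAI

end

/-! A successful algorithm must tell the model `ν` from every model `ν'` that calls for another
answer, and its observations separate the two no better than their accumulated relative entropy
allows. Let S_n be the log-likelihood ratio of `ν` to `ν'`, summed over those of the first n rounds
that are played before stopping. Change of measure (`lintegral_mul_exp_neg_obsSum_le`) gives E_ν[F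
exp(-S_n)] ≤ E_ν'[F] for nonnegative F that depend on the observations only. If no arm has relative
entropy above D ≥ 0, a Wald argument (`integral_obsSum_le`) gives E_ν[S_n] ≤ D ∑_{s<n} P_ν(T > s) ≤
D E_ν[T]. Combined through log t ≤ t - 1 at t = F exp(-S_n), they yield 1 + E_ν[log F] - E_ν'[F] ≤ D
E_ν[T] (`log_add_log_sub_le`). For δ < 1/2, a two-valued F adapted to δ makes the left side at least
d(1-δ, δ) ≥ ln(1/(2δ)) - δ; for δ ≥ 1/2 the numerator is negative.

It remains to choose `ν'`. If there are good arms, the coordinate of each good arm with the smallest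
d(μ, ξ) is pushed just below its threshold: no arm stays good, and each arm costs at most the
denominator plus ε. For the second part, all arms of the hard model have means (x, 1, …, 1) with x
slightly below the first threshold. Raising x just above it in one arm creates a good arm at a cost
close to d(x, ξ), which is the smallest entropy of every arm because x is so close. Means are moved
past the thresholds, never onto them, so that `ν'` is nondegenerate and hence lies in the class. -/

noncomputable section

namespace MTGAI

/-! ### Resampling in an i.i.d. sequence. -/

/-- Resampling one coordinate of an i.i.d. sequence does not change its law. -/
lemma lintegral_infinitePi_update {X : Type*} [MeasurableSpace X] (π : Measure X)
    [IsProbabilityMeasure π] (n : ℕ) {f : (ℕ → X) → ℝ≥0∞} (hf : Measurable f) :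
    ∫⁻ z, f z ∂(Measure.infinitePi fun _ : ℕ => π) =
      ∫⁻ z, ∫⁻ x, f (Function.update z n x) ∂π ∂(Measure.infinitePi fun _ : ℕ => π) := by
  have hm : Measurable fun q : (ℕ → X) × X => Function.update q.1 n q.2 := measurable_update'
  have key : ((Measure.infinitePi fun _ : ℕ => π).prod π).map
      (fun q => Function.update q.1 n q.2) = Measure.infinitePi fun _ : ℕ => π := by
    -- Finite cylinders determine a product measure; on a cylinder, the condition on coordinate `n`
    -- falls on the fresh variable alone.
    refine Measure.eq_infinitePi _ fun s t ht => ?_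
    rw [Measure.map_apply hm (MeasurableSet.pi s.countable_toSet fun i _ => ht i)]
    by_cases hn : n ∈ s
    · have : (fun q : (ℕ → X) × X => Function.update q.1 n q.2) ⁻¹' (Set.pi s t) =
          (Set.pi (s.erase n : Finset ℕ) t) ×ˢ (t n) := by
        ext q
        simp only [Set.mem_preimage, Set.mem_pi, Set.mem_prod, Finset.mem_coe, Finset.mem_erase]
        constructor
        · intro h
          refine ⟨fun i hi => ?_, ?_⟩
          · simpa [Function.update_of_ne hi.1] using h i hi.2
          · simpa using h n hn
        · rintro ⟨h1, h2⟩ i hi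
          by_cases hin : i = n
          · subst hin; simpa using h2
          · simpa [Function.update_of_ne hin] using h1 i ⟨hin, hi⟩
      rw [this, Measure.prod_prod, Measure.infinitePi_pi _ (fun i _ => ht i),
        Finset.prod_erase_mul _ _ hn]
    · have : (fun q : (ℕ → X) × X => Function.update q.1 n q.2) ⁻¹' (Set.pi s t) =
          (Set.pi s t) ×ˢ Set.univ := by
        ext q
        simp only [Set.mem_preimage, Set.mem_pi, Set.mem_prod, Finset.mem_coe, Set.mem_univ,
          and_true]
        refine forall₂_congr fun i hi => ?_
        rw [Function.update_of_ne (by rintro rfl; exact hn hi)]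
      rw [this, Measure.prod_prod, Measure.infinitePi_pi _ (fun i _ => ht i)]
      simp
  conv_lhs => rw [← key]
  rw [lintegral_map hf hm, lintegral_prod (fun q => f (Function.update q.1 n q.2)) (hf.comp hm).aemeasurable]

/-! ### Histories, activity and observational equivalence of outcomes. -/

namespace Algorithm

variable {K M : ℕ}

instance (A : Algorithm K M) (ν : BanditModel K M) : IsProbabilityMeasure (A.outcomeLaw ν) := by
  unfold outcomeLaw; infer_instance

/-- The arm chosen in the round that follows `n` completed rounds. -/
def action (A : Algorithm K M) (ω : A.Outcome) (n : ℕ) : Fin K := A.sample n (ω.1, A.history ω n)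

/-- The reward vector observed in the round that follows `n` completed rounds. -/
def reward (A : Algorithm K M) (ω : A.Outcome) (n : ℕ) : Fin M → ℝ := ω.2 n (A.action ω n)

/-- The algorithm has not stopped after `n` rounds or earlier. -/
def Active (A : Algorithm K M) (ω : A.Outcome) (n : ℕ) : Prop :=
  ∀ s ≤ n, (ω.1, A.history ω s) ∉ A.stopSet s

/-- Replace the reward vectors that follow `n` completed rounds. -/
def resample (A : Algorithm K M) (n : ℕ) (ω : A.Outcome) (x : Fin K → Fin M → ℝ) : A.Outcome :=
  (ω.1, Function.update ω.2 n x)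

/-- The player makes the same observations in the first `n` rounds, or until it stops. -/
def SameObs (A : Algorithm K M) (n : ℕ) (ω ω' : A.Outcome) : Prop :=
  ω.1 = ω'.1 ∧ ∀ s < n, A.Active ω s → A.reward ω s = ω'.2 s (A.action ω s)

lemma history_succ (A : Algorithm K M) (ω : A.Outcome) (t : ℕ) :
    A.history ω (t + 1) = Fin.snoc (α := fun _ => Fin K × (Fin M → ℝ)) (A.history ω t)
      (A.action ω t, A.reward ω t) := rfl

lemma lt_stoppingTime_iff (A : Algorithm K M) (ω : A.Outcome) (n : ℕ) :
    (n : ℕ∞) < A.stoppingTime ω ↔ A.Active ω n := by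
  rw [← not_le]
  constructor
  · intro h s hs hst
    exact h ((iInf₂_le s hst).trans (by exact_mod_cast hs))
  · intro h hle
    have : ((n + 1 : ℕ) : ℕ∞) ≤ A.stoppingTime ω := by
      refine le_iInf₂ fun t ht => ?_
      have : ¬ t ≤ n := fun htn => h t htn ht
      exact_mod_cast (by omega : n + 1 ≤ t)
    have h2 := this.trans hle
    have : n + 1 ≤ n := by exact_mod_cast h2
    omega

lemma Active.mono {A : Algorithm K M} {ω : A.Outcome} {m n : ℕ} (h : A.Active ω n) (hmn : m ≤ n) :
    A.Active ω m := fun s hs => h s (hs.trans hmn)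

lemma measurable_uncurry_apply {Y : Type*} [MeasurableSpace Y] :
    Measurable fun q : Fin K × (Fin K → Y) => q.2 q.1 :=
  measurable_from_prod_countable_right fun i => measurable_pi_apply i

lemma measurable_fst_history (A : Algorithm K M) (n : ℕ) :
    Measurable fun ω : A.Outcome => (ω.1, A.history ω n) := by
  induction n with
  | zero =>
    refine measurable_fst.prodMk ?_
    exact measurable_pi_iff.2 fun i => i.elim0
  | succ n ih =>
    refine measurable_fst.prodMk (measurable_pi_iff.2 fun i => ?_)
    have ha : Measurable fun ω : A.Outcome => A.action ω n := (A.measurable_sample n).comp ih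
    refine Fin.lastCases ?_ (fun j => ?_) i
    · simp only [history_succ, Fin.snoc_last]
      refine ha.prodMk ?_
      exact measurable_uncurry_apply.comp
        (ha.prodMk ((measurable_pi_apply n).comp measurable_snd))
    · simp only [history_succ, Fin.snoc_castSucc]
      exact (measurable_pi_apply j).comp (measurable_snd.comp ih)

lemma measurable_action (A : Algorithm K M) (n : ℕ) :
    Measurable fun ω : A.Outcome => A.action ω n :=
  (A.measurable_sample n).comp (A.measurable_fst_history n)

lemma measurable_reward (A : Algorithm K M) (n : ℕ) :
    Measurable fun ω : A.Outcome => A.reward ω n :=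
  measurable_uncurry_apply.comp
    ((A.measurable_action n).prodMk ((measurable_pi_apply n).comp measurable_snd))

lemma measurableSet_active (A : Algorithm K M) (n : ℕ) :
    MeasurableSet {ω : A.Outcome | A.Active ω n} := by
  have : {ω : A.Outcome | A.Active ω n} =
      ⋂ s, ⋂ (_ : s ≤ n), (fun ω : A.Outcome => (ω.1, A.history ω s)) ⁻¹' (A.stopSet s)ᶜ := by
    ext ω; simp [Active]
  rw [this]
  exact MeasurableSet.iInter fun s => MeasurableSet.iInter fun _ =>
    (A.measurable_fst_history s) (A.measurableSet_stopSet s).compl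

lemma measurable_resample (A : Algorithm K M) (n : ℕ) :
    Measurable fun q : A.Outcome × (Fin K → Fin M → ℝ) => A.resample n q.1 q.2 := by
  have h : Measurable fun q : (ℕ → Fin K → Fin M → ℝ) × (Fin K → Fin M → ℝ) =>
    Function.update q.1 n q.2 := measurable_update'
  exact (measurable_fst.comp measurable_fst).prodMk
    (h.comp ((measurable_snd.comp measurable_fst).prodMk measurable_snd))

lemma lintegral_resample (A : Algorithm K M) (ν : BanditModel K M) (n : ℕ)
    {f : A.Outcome → ℝ≥0∞} (hf : Measurable f) :
    ∫⁻ ω, f ω ∂(A.outcomeLaw ν) =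
      ∫⁻ ω, ∫⁻ x, f (A.resample n ω x) ∂(Measure.pi ν.law) ∂(A.outcomeLaw ν) := by
  have hg : Measurable fun ω : A.Outcome => ∫⁻ x, f (A.resample n ω x) ∂(Measure.pi ν.law) :=
    (hf.comp (A.measurable_resample n)).lintegral_prod_right'
  unfold outcomeLaw
  rw [lintegral_prod _ hf.aemeasurable, lintegral_prod _ hg.aemeasurable]
  refine lintegral_congr fun u => ?_
  exact lintegral_infinitePi_update _ n (hf.comp measurable_prodMk_left)

/-- The form of `lintegral_resample` that also serves for signed integrands, as needed in the Wald
inequality. -/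
lemma measurePreserving_resample (A : Algorithm K M) (ν : BanditModel K M) (n : ℕ) :
    MeasurePreserving (fun q : A.Outcome × (Fin K → Fin M → ℝ) => A.resample n q.1 q.2)
      ((A.outcomeLaw ν).prod (Measure.pi ν.law)) (A.outcomeLaw ν) := by
  refine ⟨A.measurable_resample n, Measure.ext_of_lintegral _ fun f hf => ?_⟩
  rw [lintegral_map hf (A.measurable_resample n),
    lintegral_prod (fun q => f (A.resample n q.1 q.2))
      (hf.comp (A.measurable_resample n)).aemeasurable, A.lintegral_resample ν n hf]

/-- The history after `s` rounds involves the reward vectors of index below `s` only. So the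
decisions made after `n` rounds ignore the vector that is resampled at index `n`. -/
lemma history_resample (A : Algorithm K M) (n : ℕ) (ω : A.Outcome) (x : Fin K → Fin M → ℝ)
    {s : ℕ} (hs : s ≤ n) : A.history (A.resample n ω x) s = A.history ω s := by
  induction s with
  | zero => rfl
  | succ s ih =>
    have h := ih (by omega)
    have ha : A.action (A.resample n ω x) s = A.action ω s := by
      simp only [action, h]; rfl
    have hr : A.reward (A.resample n ω x) s = A.reward ω s := by
      unfold reward
      rw [ha]
      simp only [resample]
      rw [Function.update_of_ne (by omega)]
    rw [history_succ, history_succ, h, ha, hr]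

lemma action_resample (A : Algorithm K M) (n : ℕ) (ω : A.Outcome) (x : Fin K → Fin M → ℝ)
    {s : ℕ} (hs : s ≤ n) : A.action (A.resample n ω x) s = A.action ω s := by
  simp only [action, A.history_resample n ω x hs]; rfl

lemma active_resample (A : Algorithm K M) (n : ℕ) (ω : A.Outcome) (x : Fin K → Fin M → ℝ)
    {s : ℕ} (hs : s ≤ n) : A.Active (A.resample n ω x) s ↔ A.Active ω s := by
  refine forall₂_congr fun r hr => ?_
  rw [A.history_resample n ω x (hr.trans hs)]; rfl

lemma reward_resample_of_lt (A : Algorithm K M) (n : ℕ) (ω : A.Outcome)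
    (x : Fin K → Fin M → ℝ) {s : ℕ} (hs : s < n) :
    A.reward (A.resample n ω x) s = A.reward ω s := by
  unfold reward
  rw [A.action_resample n ω x hs.le]
  simp only [resample]
  rw [Function.update_of_ne (by omega)]

lemma reward_resample_self (A : Algorithm K M) (n : ℕ) (ω : A.Outcome)
    (x : Fin K → Fin M → ℝ) : A.reward (A.resample n ω x) n = x (A.action ω n) := by
  unfold reward
  rw [A.action_resample n ω x le_rfl]
  simp [resample]

/-- Activity before `s` is needed because `SameObs` does not constrain the rewards that come after
stopping. -/
lemma SameObs.history_eq {A : Algorithm K M} {n : ℕ} {ω ω' : A.Outcome} (h : A.SameObs n ω ω')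
    {s : ℕ} (hs : s ≤ n) (hact : ∀ r < s, A.Active ω r) :
    A.history ω s = A.history ω' s := by
  induction s with
  | zero => rfl
  | succ s ih =>
    have hh := ih (by omega) fun r hr => hact r (by omega)
    have ha : A.action ω s = A.action ω' s := by simp only [action, hh, h.1]
    have hr := h.2 s (by omega) (hact s (by omega))
    rw [history_succ, history_succ, hh, hr, ha]
    rfl

lemma SameObs.active_iff {A : Algorithm K M} {n : ℕ} {ω ω' : A.Outcome} (h : A.SameObs n ω ω')
    {s : ℕ} (hs : s ≤ n) : A.Active ω s ↔ A.Active ω' s := by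
  induction s with
  | zero =>
    refine forall₂_congr fun r hr => ?_
    obtain rfl : r = 0 := by omega
    rw [h.1]; rfl
  | succ s ih =>
    have succ_iff : ∀ ω : A.Outcome, A.Active ω (s + 1) ↔
        A.Active ω s ∧ (ω.1, A.history ω (s + 1)) ∉ A.stopSet (s + 1) := by
      intro ω
      refine ⟨fun H => ⟨H.mono (by omega), H _ le_rfl⟩, fun H r hr => ?_⟩
      rcases Nat.lt_or_ge s r with h1 | h1
      · obtain rfl : r = s + 1 := by omega
        exact H.2
      · exact H.1 r h1
    rw [succ_iff, succ_iff, ← ih (by omega)]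
    refine and_congr_right fun hact => ?_
    rw [h.history_eq hs fun r hr => hact.mono (by omega), h.1]

/-- Makes the average of a function over the reward vector of round `n` depend on the earlier
observations only: the inductive step of the change of measure. -/
lemma SameObs.resample {A : Algorithm K M} {n : ℕ} {ω ω' : A.Outcome} (h : A.SameObs n ω ω')
    (x : Fin K → Fin M → ℝ) : A.SameObs (n + 1) (A.resample n ω x) (A.resample n ω' x) := by
  refine ⟨h.1, fun s hs hact => ?_⟩
  rcases Nat.lt_succ_iff_lt_or_eq.1 hs with hlt | rfl
  · rw [A.active_resample n ω x hlt.le] at hact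
    rw [A.reward_resample_of_lt n ω x hlt, A.action_resample n ω x hlt.le, h.2 s hlt hact]
    simp only [Algorithm.resample]
    rw [Function.update_of_ne (by omega)]
  · rw [A.reward_resample_self, A.action_resample _ _ _ le_rfl]
    simp [Algorithm.resample]

/-- After the algorithm has stopped, nothing is observed; before, only the reward vector of the
chosen arm is. -/
lemma sameObs_resample_resample (A : Algorithm K M) (n : ℕ) (ω : A.Outcome)
    (x y : Fin K → Fin M → ℝ) (h : A.Active ω n → x (A.action ω n) = y (A.action ω n)) :
    A.SameObs (n + 1) (A.resample n ω x) (A.resample n ω y) := by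
  refine ⟨rfl, fun s hs hact => ?_⟩
  rcases Nat.lt_succ_iff_lt_or_eq.1 hs with hlt | rfl
  · rw [A.active_resample n ω x hlt.le] at hact
    rw [A.reward_resample_of_lt n ω x hlt, A.action_resample n ω x hlt.le]
    simp only [Algorithm.resample, reward]
    rw [Function.update_of_ne (by omega)]
  · rw [A.active_resample _ ω x le_rfl] at hact
    rw [A.reward_resample_self, A.action_resample _ _ _ le_rfl, h hact]
    simp [Algorithm.resample]

/-! ### Change of measure and Wald's inequality. -/

open Classical in
/-- The sum of `φ` over the observations of the first `n` rounds, until the algorithm stops. -/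
def obsSum (A : Algorithm K M) (φ : Fin K → (Fin M → ℝ) → ℝ) (n : ℕ) (ω : A.Outcome) : ℝ :=
  ∑ s ∈ Finset.range n, if A.Active ω s then φ (A.action ω s) (A.reward ω s) else 0

lemma measurable_obsTerm (A : Algorithm K M) {φ : Fin K → (Fin M → ℝ) → ℝ}
    (hφ : ∀ i, Measurable (φ i)) (s : ℕ) :
    Measurable fun ω : A.Outcome => φ (A.action ω s) (A.reward ω s) := by
  have h : Measurable fun q : Fin K × (Fin M → ℝ) => φ q.1 q.2 :=
    measurable_from_prod_countable_right hφ
  exact h.comp ((A.measurable_action s).prodMk (A.measurable_reward s))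

open Classical in
lemma measurable_obsSum (A : Algorithm K M) {φ : Fin K → (Fin M → ℝ) → ℝ}
    (hφ : ∀ i, Measurable (φ i)) (n : ℕ) : Measurable (A.obsSum φ n) := by
  unfold obsSum
  exact Finset.measurable_sum _ fun s _ =>
    Measurable.ite (A.measurableSet_active s) (A.measurable_obsTerm hφ s) measurable_const

open Classical in
lemma obsSum_succ_resample (A : Algorithm K M) (φ : Fin K → (Fin M → ℝ) → ℝ) (n : ℕ)
    (ω : A.Outcome) (x : Fin K → Fin M → ℝ) :
    A.obsSum φ (n + 1) (A.resample n ω x) =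
      A.obsSum φ n ω + if A.Active ω n then φ (A.action ω n) (x (A.action ω n)) else 0 := by
  unfold obsSum
  rw [Finset.sum_range_succ]
  congr 1
  · refine Finset.sum_congr rfl fun s hs => ?_
    have hs := Finset.mem_range.1 hs
    rw [A.active_resample n ω x hs.le, A.action_resample n ω x hs.le,
      A.reward_resample_of_lt n ω x hs]
  · rw [A.active_resample n ω x le_rfl, A.action_resample n ω x le_rfl,
      A.reward_resample_self n ω x]

/-- Change of measure for functions of the observations made in the first `n` rounds. -/
theorem lintegral_mul_exp_neg_obsSum_le (A : Algorithm K M) {ν ν' : BanditModel K M}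
    {φ : Fin K → (Fin M → ℝ) → ℝ} (hφ : ∀ i, Measurable (φ i))
    (hle : ∀ i, (ν.law i).withDensity (fun y => ENNReal.ofReal (Real.exp (-φ i y))) ≤ ν'.law i)
    (n : ℕ) {F : A.Outcome → ℝ≥0∞} (hF : Measurable F)
    (hobs : ∀ ω ω', A.SameObs n ω ω' → F ω = F ω') :
    ∫⁻ ω, F ω * ENNReal.ofReal (Real.exp (-A.obsSum φ n ω)) ∂(A.outcomeLaw ν) ≤
      ∫⁻ ω, F ω ∂(A.outcomeLaw ν') := by
  classical
  have hle' : ∀ i, ∀ G : (Fin M → ℝ) → ℝ≥0∞, Measurable G →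
      ∫⁻ y, G y * ENNReal.ofReal (Real.exp (-φ i y)) ∂(ν.law i) ≤ ∫⁻ y, G y ∂(ν'.law i) := by
    intro i G hG
    have hm : Measurable fun y => ENNReal.ofReal (Real.exp (-φ i y)) :=
      ENNReal.measurable_ofReal.comp (Real.measurable_exp.comp (hφ i).neg)
    have h := lintegral_withDensity_eq_lintegral_mul (ν.law i) hm hG
    calc _ = ∫⁻ y, G y ∂((ν.law i).withDensity
            (fun y => ENNReal.ofReal (Real.exp (-φ i y)))) := by
          rw [h]; simp [mul_comm]
      _ ≤ _ := lintegral_mono' (hle i) le_rfl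
  induction n generalizing F with
  | zero =>
    -- With no rounds observed, only the seed matters, and its law is the same under both models.
    have hseed : ∀ ω, F ω = F (ω.1, 0) := fun ω =>
      hobs _ _ ⟨rfl, fun s hs => absurd hs (Nat.not_lt_zero s)⟩
    have hval : ∀ ν : BanditModel K M,
        ∫⁻ ω, F ω ∂(A.outcomeLaw ν) = ∫⁻ u, F (u, 0) ∂A.seedLaw := by
      intro ν
      unfold outcomeLaw
      rw [lintegral_prod _ hF.aemeasurable]
      refine lintegral_congr fun u => ?_
      rw [lintegral_congr fun z => hseed (u, z)]
      simp
    simp [obsSum, hval]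
  | succ n ih =>
    -- The last round is averaged under `ν'`: once its likelihood factor has been absorbed, the
    -- induction hypothesis for `F'` handles the earlier rounds.
    set F' : A.Outcome → ℝ≥0∞ := fun ω => ∫⁻ x, F (A.resample n ω x) ∂(Measure.pi ν'.law)
      with hF'
    have hFr : Measurable fun q : A.Outcome × (Fin K → Fin M → ℝ) => F (A.resample n q.1 q.2) :=
      hF.comp (A.measurable_resample n)
    have hF'm : Measurable F' := hFr.lintegral_prod_right'
    have hexp : ∀ n, Measurable fun ω => ENNReal.ofReal (Real.exp (-A.obsSum φ n ω)) := fun n =>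
      ENNReal.measurable_ofReal.comp (Real.measurable_exp.comp (A.measurable_obsSum hφ n).neg)
    have hF'obs : ∀ ω ω', A.SameObs n ω ω' → F' ω = F' ω' := fun ω ω' h =>
      lintegral_congr fun x => hobs _ _ (h.resample x)
    rw [A.lintegral_resample ν n
        (f := fun ω => F ω * ENNReal.ofReal (Real.exp (-A.obsSum φ (n + 1) ω)))
        (hF.mul (hexp _)),
      A.lintegral_resample ν' n hF]
    refine le_trans (lintegral_mono fun ω => ?_) (ih hF'm hF'obs)
    have hFx : Measurable fun x => F (A.resample n ω x) := hFr.comp measurable_prodMk_left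
    simp only [obsSum_succ_resample]
    by_cases hact : A.Active ω n
    · simp only [hact, if_true]
      set a := A.action ω n
      -- `F` sees only the reward of the chosen arm, so that reward may be given to all arms at
      -- once.
      set G : (Fin M → ℝ) → ℝ≥0∞ := fun y => F (A.resample n ω fun _ => y) with hG
      have hGm : Measurable G := hFx.comp (measurable_pi_iff.2 fun _ => measurable_id)
      have hFG : ∀ x, F (A.resample n ω x) = G (x a) := fun x =>
        hobs _ _ (A.sameObs_resample_resample n ω _ _ fun _ => rfl)
      have hGe : Measurable fun y => G y * ENNReal.ofReal (Real.exp (-φ a y)) :=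
        hGm.mul (ENNReal.measurable_ofReal.comp (Real.measurable_exp.comp (hφ a).neg))
      calc ∫⁻ x, F (A.resample n ω x) *
              ENNReal.ofReal (Real.exp (-(A.obsSum φ n ω + φ a (x a)))) ∂(Measure.pi ν.law)
          = ∫⁻ x, (G (x a) * ENNReal.ofReal (Real.exp (-φ a (x a)))) *
              ENNReal.ofReal (Real.exp (-A.obsSum φ n ω)) ∂(Measure.pi ν.law) := by
            refine lintegral_congr fun x => ?_
            rw [hFG, neg_add, Real.exp_add, ENNReal.ofReal_mul (Real.exp_nonneg _)]
            ring
        _ = (∫⁻ x, G (x a) * ENNReal.ofReal (Real.exp (-φ a (x a))) ∂(Measure.pi ν.law)) *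
              ENNReal.ofReal (Real.exp (-A.obsSum φ n ω)) :=
            lintegral_mul_const _ (hGe.comp (measurable_pi_apply a))
        _ = (∫⁻ y, G y * ENNReal.ofReal (Real.exp (-φ a y)) ∂(ν.law a)) *
              ENNReal.ofReal (Real.exp (-A.obsSum φ n ω)) := by
            rw [(measurePreserving_eval ν.law a).lintegral_comp hGe]
        _ ≤ (∫⁻ y, G y ∂(ν'.law a)) * ENNReal.ofReal (Real.exp (-A.obsSum φ n ω)) := by
            exact mul_le_mul_of_nonneg_right (hle' a G hGm) zero_le
        _ = F' ω * ENNReal.ofReal (Real.exp (-A.obsSum φ n ω)) := by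
            rw [hF', ← (measurePreserving_eval ν'.law a).lintegral_comp hGm]
            simp only [hFG, Function.eval]
    · have hconst : ∀ x, F (A.resample n ω x) = F (A.resample n ω 0) := fun x =>
        hobs _ _ (A.sameObs_resample_resample n ω _ _ fun h => absurd h hact)
      simp only [hact, if_false, add_zero, hconst]
      simp

open Classical in
/-- An inequality of Wald's type. -/
theorem integral_obsSum_le (A : Algorithm K M) (ν : BanditModel K M)
    {φ : Fin K → (Fin M → ℝ) → ℝ} (hφ : ∀ i, Measurable (φ i)) {B D : ℝ}
    (hB : ∀ i y, |φ i y| ≤ B) (hD : ∀ i, ∫ y, φ i y ∂(ν.law i) ≤ D) (n : ℕ) :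
    ∫ ω, A.obsSum φ n ω ∂(A.outcomeLaw ν) ≤
      D * ∑ s ∈ Finset.range n, (A.outcomeLaw ν).real {ω | A.Active ω s} := by
  have hB' : ∀ i y, |φ i y| ≤ |B| := fun i y => (hB i y).trans (le_abs_self B)
  have hm : ∀ s, Measurable fun ω : A.Outcome =>
      if A.Active ω s then φ (A.action ω s) (A.reward ω s) else 0 := fun s =>
    Measurable.ite (A.measurableSet_active s) (A.measurable_obsTerm hφ s) measurable_const
  have hbd : ∀ s (ω : A.Outcome),
      ‖if A.Active ω s then φ (A.action ω s) (A.reward ω s) else 0‖ ≤ |B| := by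
    intro s ω
    split_ifs
    · exact hB' _ _
    · simp
  unfold obsSum
  rw [integral_finsetSum _ fun s _ =>
    Integrable.of_bound (hm s).aestronglyMeasurable _ (ae_of_all _ (hbd s)), Finset.mul_sum]
  refine Finset.sum_le_sum fun s _ => ?_
  -- Activity and the chosen arm are fixed by the past, so integrating the fresh reward first yields
  -- the mean of `φ` under the law of that arm.
  have hmp := A.measurePreserving_resample ν s
  rw [← hmp.map_eq, integral_map hmp.measurable.aemeasurable
    (by exact (hm s).aestronglyMeasurable), integral_prod]
  swap
  · exact Integrable.of_bound ((hm s).comp hmp.measurable).aestronglyMeasurable |B|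
      (ae_of_all _ fun q => hbd s _)
  rw [hmp.map_eq]
  have hind : D * (A.outcomeLaw ν).real {ω | A.Active ω s} =
      ∫ ω, {ω | A.Active ω s}.indicator (fun _ => D) ω ∂(A.outcomeLaw ν) := by
    rw [integral_indicator_const _ (A.measurableSet_active s), smul_eq_mul, mul_comm]
  rw [hind]
  have hint : ∀ ω : A.Outcome, ∫ x, (if A.Active (A.resample s ω x) s then
        φ (A.action (A.resample s ω x) s) (A.reward (A.resample s ω x) s) else 0)
          ∂(Measure.pi ν.law) =
      if A.Active ω s then ∫ y, φ (A.action ω s) y ∂(ν.law (A.action ω s)) else 0 := by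
    intro ω
    simp only [A.active_resample s ω _ le_rfl, A.action_resample s ω _ le_rfl,
      A.reward_resample_self s ω]
    split_ifs
    · have hmp' := measurePreserving_eval ν.law (A.action ω s)
      rw [← hmp'.map_eq, integral_map hmp'.measurable.aemeasurable
        (hφ _).aestronglyMeasurable]
    · simp
  simp only [hint]
  have hle : ∀ ω : A.Outcome,
      (if A.Active ω s then ∫ y, φ (A.action ω s) y ∂(ν.law (A.action ω s)) else 0) ≤
        {ω | A.Active ω s}.indicator (fun _ => D) ω := by
    intro ω
    rw [Set.indicator_apply]
    simp only [Set.mem_ofPred_eq]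
    split_ifs
    · exact hD _
    · exact le_rfl
  refine integral_mono ?_ ((integrable_const D).indicator (A.measurableSet_active s)) hle
  refine Integrable.of_bound (C := |B|) ?_ (ae_of_all _ fun ω => ?_)
  · refine (Measurable.ite (A.measurableSet_active s) ?_ measurable_const).aestronglyMeasurable
    exact (measurable_of_countable fun i => ∫ y, φ i y ∂(ν.law i)).comp (A.measurable_action s)
  · split_ifs
    · refine (norm_integral_le_of_norm_le_const (ae_of_all _ fun y => hB' _ y)).trans ?_
      simp
    · simp

/-! ### Output events and the expected stopping time. -/

lemma stoppingTime_eq_iff (A : Algorithm K M) (ω : A.Outcome) (t : ℕ) :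
    A.stoppingTime ω = t ↔ ¬ A.Active ω t ∧ ∀ s < t, A.Active ω s := by
  simp only [← lt_stoppingTime_iff, not_lt]
  constructor
  · intro h
    rw [h]
    exact ⟨le_rfl, fun s hs => by exact_mod_cast hs⟩
  · rintro ⟨h1, h2⟩
    refine le_antisymm h1 (not_lt.1 fun hlt => ?_)
    obtain ⟨k, hk⟩ := ENat.ne_top_iff_exists.1 hlt.ne_top
    rw [← hk] at hlt h2
    exact lt_irrefl _ (h2 k (by exact_mod_cast hlt))

/-- The algorithm stops after at most `n` rounds, with an output in `S`. -/
def outputEvent (A : Algorithm K M) (S : Set (Option (Fin K))) (n : ℕ) : Set A.Outcome :=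
  {ω | ∃ t ≤ n, A.stoppingTime ω = t ∧ A.recommend t (ω.1, A.history ω t) ∈ S}

/-- Whether the algorithm stops within `n` rounds, and with what answer, is settled by the
observations of these rounds; this makes the event admissible in the change of measure. -/
lemma SameObs.mem_outputEvent {A : Algorithm K M} {n : ℕ} {ω ω' : A.Outcome}
    (h : A.SameObs n ω ω') (S : Set (Option (Fin K))) :
    ω ∈ A.outputEvent S n ↔ ω' ∈ A.outputEvent S n := by
  refine exists_congr fun t => and_congr_right fun ht => ?_
  have hst : A.stoppingTime ω = t ↔ A.stoppingTime ω' = t := by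
    rw [stoppingTime_eq_iff, stoppingTime_eq_iff, h.active_iff ht]
    exact and_congr_right fun _ => forall₂_congr fun s hs => h.active_iff (hs.le.trans ht)
  rw [← hst]
  refine and_congr_right fun hT => ?_
  rw [h.history_eq ht ((A.stoppingTime_eq_iff ω t).1 hT).2, h.1]

lemma measurableSet_stoppingTime_eq (A : Algorithm K M) (t : ℕ) :
    MeasurableSet {ω : A.Outcome | A.stoppingTime ω = t} := by
  have : {ω : A.Outcome | A.stoppingTime ω = t} =
      {ω | A.Active ω t}ᶜ ∩ ⋂ s, ⋂ (_ : s < t), {ω | A.Active ω s} := by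
    ext ω; simp [stoppingTime_eq_iff]
  rw [this]
  exact (A.measurableSet_active t).compl.inter
    (MeasurableSet.iInter fun s => MeasurableSet.iInter fun _ => A.measurableSet_active s)

lemma measurableSet_outputEvent (A : Algorithm K M) (S : Set (Option (Fin K))) (n : ℕ) :
    MeasurableSet (A.outputEvent S n) := by
  have : A.outputEvent S n = ⋃ t, ⋃ (_ : t ≤ n), {ω | A.stoppingTime ω = t} ∩
      ⋃ o, ⋃ (_ : o ∈ S), (fun ω : A.Outcome => (ω.1, A.history ω t)) ⁻¹'
        (A.recommend t ⁻¹' {o}) := by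
    ext ω; simp [outputEvent, and_left_comm]
  rw [this]
  exact MeasurableSet.iUnion fun t => MeasurableSet.iUnion fun _ =>
    (A.measurableSet_stoppingTime_eq t).inter (MeasurableSet.iUnion fun o =>
      MeasurableSet.iUnion fun _ => (A.measurable_fst_history t) (A.measurableSet_recommend t o))

lemma monotone_outputEvent (A : Algorithm K M) (S : Set (Option (Fin K))) :
    Monotone (A.outputEvent S) :=
  fun _ _ hmn _ ⟨t, ht, h⟩ => ⟨t, ht.trans hmn, h⟩

lemma iUnion_outputEvent (A : Algorithm K M) (S : Set (Option (Fin K))) :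
    ⋃ n, A.outputEvent S n = {ω | ∃ o ∈ S, A.Outputs ω o} := by
  ext ω
  simp only [Set.mem_iUnion, outputEvent, Outputs, Set.mem_ofPred_eq]
  constructor
  · rintro ⟨n, t, -, h, hS⟩
    exact ⟨_, hS, t, h, rfl⟩
  · rintro ⟨o, hS, t, h, rfl⟩
    exact ⟨t, t, le_rfl, h, hS⟩

lemma tendsto_measureReal_outputEvent (A : Algorithm K M) (S : Set (Option (Fin K)))
    (ν : BanditModel K M) :
    Filter.Tendsto (fun n => (A.outcomeLaw ν).real (A.outputEvent S n)) Filter.atTop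
      (nhds ((A.outcomeLaw ν).real {ω | ∃ o ∈ S, A.Outputs ω o})) := by
  rw [← iUnion_outputEvent]
  exact (ENNReal.tendsto_toReal (measure_ne_top _ _)).comp
    (tendsto_measure_iUnion_atTop (A.monotone_outputEvent S))

lemma measurableSet_outputs (A : Algorithm K M) (S : Set (Option (Fin K))) :
    MeasurableSet {ω | ∃ o ∈ S, A.Outputs ω o} := by
  rw [← iUnion_outputEvent]
  exact MeasurableSet.iUnion fun n => A.measurableSet_outputEvent S n

/-- The tail sum formula E[T] = ∑ P(T > s), truncated at `n`. -/
lemma sum_measureReal_active_le (A : Algorithm K M) (ν : BanditModel K M)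
    (hT : A.expectedStoppingTime ν ≠ ⊤) (n : ℕ) :
    ∑ s ∈ Finset.range n, (A.outcomeLaw ν).real {ω | A.Active ω s} ≤
      (A.expectedStoppingTime ν).toReal := by
  simp only [measureReal_def]
  rw [← ENNReal.toReal_sum fun s _ => measure_ne_top _ _]
  refine ENNReal.toReal_mono hT ?_
  calc ∑ s ∈ Finset.range n, A.outcomeLaw ν {ω | A.Active ω s}
      = ∑ s ∈ Finset.range n,
          ∫⁻ ω, {ω | A.Active ω s}.indicator 1 ω ∂(A.outcomeLaw ν) :=
        Finset.sum_congr rfl fun s _ => (lintegral_indicator_one (A.measurableSet_active s)).symm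
    _ = ∫⁻ ω, ∑ s ∈ Finset.range n, {ω | A.Active ω s}.indicator 1 ω ∂(A.outcomeLaw ν) :=
        (lintegral_finsetSum _ fun s _ => measurable_one.indicator (A.measurableSet_active s)).symm
    _ ≤ A.expectedStoppingTime ν := lintegral_mono fun ω => ?_
  classical
  simp only [Set.indicator_apply, Set.mem_ofPred_eq, Pi.one_apply, Finset.sum_boole,
    ← lt_stoppingTime_iff]
  rcases eq_or_ne (A.stoppingTime ω) ⊤ with h | h
  · simp [h]
  · obtain ⟨k, hk⟩ := ENat.ne_top_iff_exists.1 h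
    rw [← hk]
    have hsub : (Finset.range n).filter (fun s : ℕ => (s : ℕ∞) < k) ⊆ Finset.range k := by
      intro s hs
      have := (Finset.mem_filter.1 hs).2
      exact Finset.mem_range.2 (by exact_mod_cast this)
    have := Finset.card_le_card hsub
    rw [Finset.card_range] at this
    simpa using this

/-! ### Data processing and the bound for two distinguishable models. -/

/-- The data processing inequality for the observations of the first `n` rounds and a binary
event, in the dual form. -/
theorem log_add_log_sub_le (A : Algorithm K M) {ν ν' : BanditModel K M}
    {φ : Fin K → (Fin M → ℝ) → ℝ} (hφ : ∀ i, Measurable (φ i)) {B D : ℝ}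
    (hB : ∀ i y, |φ i y| ≤ B) (hD : ∀ i, ∫ y, φ i y ∂(ν.law i) ≤ D)
    (hle : ∀ i, (ν.law i).withDensity (fun y => ENNReal.ofReal (Real.exp (-φ i y))) ≤ ν'.law i)
    (n : ℕ) {E : Set A.Outcome} (hE : MeasurableSet E)
    (hobs : ∀ ω ω', A.SameObs n ω ω' → (ω ∈ E ↔ ω' ∈ E)) {α β : ℝ} (hα : 0 < α) (hβ : 0 < β) :
    1 + (A.outcomeLaw ν).real E * Real.log α + (1 - (A.outcomeLaw ν).real E) * Real.log β
        - α * (A.outcomeLaw ν').real E - β * (1 - (A.outcomeLaw ν').real E) ≤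
      D * ∑ s ∈ Finset.range n, (A.outcomeLaw ν).real {ω | A.Active ω s} := by
  classical
  refine le_trans ?_ (A.integral_obsSum_le ν hφ hB hD n)
  set P := A.outcomeLaw ν
  set Q := A.outcomeLaw ν'
  set S := A.obsSum φ n
  have hSm : Measurable S := A.measurable_obsSum hφ n
  have hSb : ∀ ω, |S ω| ≤ n * |B| := by
    intro ω
    calc |S ω| ≤ ∑ s ∈ Finset.range n,
          |if A.Active ω s then φ (A.action ω s) (A.reward ω s) else 0| :=
          Finset.abs_sum_le_sum_abs _ _
      _ ≤ ∑ _s ∈ Finset.range n, |B| := by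
          refine Finset.sum_le_sum fun s _ => ?_
          split_ifs
          · exact (hB _ _).trans (le_abs_self B)
          · simp
      _ = n * |B| := by simp
  -- The test function of the variational formula for relative entropy, constant on the event and on
  -- its complement.
  set F : A.Outcome → ℝ := fun ω => if ω ∈ E then α else β with hF
  have hFpos : ∀ ω, 0 < F ω := fun ω => by simp only [hF]; split_ifs <;> assumption
  have hFle : ∀ ω, F ω ≤ α + β := fun ω => by simp only [hF]; split_ifs <;> linarith
  have hFm : Measurable F := Measurable.ite hE measurable_const measurable_const
  have hint : ∀ (ρ : Measure A.Outcome) [IsProbabilityMeasure ρ] (a b : ℝ),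
      ∫ ω, (if ω ∈ E then a else b) ∂ρ = a * ρ.real E + b * (1 - ρ.real E) := by
    intro ρ _ a b
    have : (fun ω => if ω ∈ E then a else b) =
        fun ω => E.indicator (fun _ => a) ω + Eᶜ.indicator (fun _ => b) ω := by
      ext ω
      by_cases h : ω ∈ E <;> simp [h]
    rw [this, integral_add ((integrable_const a).indicator hE)
      ((integrable_const b).indicator hE.compl), integral_indicator_const _ hE,
      integral_indicator_const _ hE.compl, measureReal_compl hE]
    simp [mul_comm]
  have hSi : Integrable S P :=
    Integrable.of_bound hSm.aestronglyMeasurable _ (ae_of_all _ hSb)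
  have hlogm : Measurable fun ω => Real.log (F ω) := Real.measurable_log.comp hFm
  have hlogi : Integrable (fun ω => Real.log (F ω)) P := by
    refine Integrable.of_bound hlogm.aestronglyMeasurable (|Real.log α| + |Real.log β|)
      (ae_of_all _ fun ω => ?_)
    simp only [hF, Real.norm_eq_abs]
    split_ifs
    · linarith [abs_nonneg (Real.log β)]
    · linarith [abs_nonneg (Real.log α)]
  have hFSm : Measurable fun ω => F ω * Real.exp (-S ω) :=
    hFm.mul (Real.measurable_exp.comp hSm.neg)
  have hFSi : Integrable (fun ω => F ω * Real.exp (-S ω)) P := by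
    refine Integrable.of_bound hFSm.aestronglyMeasurable ((α + β) * Real.exp (n * |B|))
      (ae_of_all _ fun ω => ?_)
    rw [Real.norm_eq_abs, abs_of_nonneg (mul_nonneg (hFpos ω).le (Real.exp_nonneg _))]
    refine mul_le_mul (hFle ω) (Real.exp_le_exp.2 ?_) (Real.exp_nonneg _) (by linarith)
    linarith [(abs_le.1 (hSb ω)).1]
  -- This is log t ≤ t - 1 at t = F exp(-S).
  have hpt : ∀ ω, Real.log (F ω) - S ω ≤ F ω * Real.exp (-S ω) - 1 := by
    intro ω
    have h := Real.log_le_sub_one_of_pos (mul_pos (hFpos ω) (Real.exp_pos (-S ω)))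
    rwa [Real.log_mul (hFpos ω).ne' (Real.exp_ne_zero _), Real.log_exp, ← sub_eq_add_neg] at h
  have h1 : ∫ ω, Real.log (F ω) ∂P - ∫ ω, S ω ∂P ≤ ∫ ω, F ω * Real.exp (-S ω) ∂P - 1 := by
    have := integral_mono (hlogi.sub hSi) (hFSi.sub (integrable_const 1)) hpt
    simp only [Pi.sub_apply] at this
    rw [integral_sub hlogi hSi, integral_sub hFSi (integrable_const 1)] at this
    simpa using this
  have h2 : ∫ ω, F ω * Real.exp (-S ω) ∂P ≤ ∫ ω, F ω ∂Q := by
    rw [integral_eq_lintegral_of_nonneg_ae (ae_of_all _ fun ω =>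
        mul_nonneg (hFpos ω).le (Real.exp_nonneg _)) hFSm.aestronglyMeasurable,
      integral_eq_lintegral_of_nonneg_ae (ae_of_all _ fun ω => (hFpos ω).le)
        hFm.aestronglyMeasurable]
    have hfin : ∫⁻ ω, ENNReal.ofReal (F ω) ∂Q ≠ ⊤ := by
      refine ne_top_of_le_ne_top (b := ∫⁻ _, ENNReal.ofReal (α + β) ∂Q) ?_
        (lintegral_mono fun ω => ENNReal.ofReal_le_ofReal (hFle ω))
      simp
    refine ENNReal.toReal_mono hfin ?_
    have := A.lintegral_mul_exp_neg_obsSum_le hφ hle n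
      (F := fun ω => ENNReal.ofReal (F ω)) (ENNReal.measurable_ofReal.comp hFm)
      (fun ω ω' h => by simp only [hF, hobs ω ω' h])
    refine le_trans (le_of_eq (lintegral_congr fun ω => ?_)) this
    rw [ENNReal.ofReal_mul (hFpos ω).le]
  have h3 : ∫ ω, F ω ∂Q = α * Q.real E + β * (1 - Q.real E) := hint Q α β
  have h4 : ∫ ω, Real.log (F ω) ∂P =
      Real.log α * P.real E + Real.log β * (1 - P.real E) := by
    rw [← hint P]
    simp only [hF, apply_ite Real.log]
  rw [h4] at h1
  rw [h3] at h2
  linarith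

/-- A lower bound for the binary relative entropy of `1 - δ` and `δ`. -/
lemma log_inv_two_mul_sub_le {δ : ℝ} (h0 : 0 < δ) (h1 : δ < 1 / 2) :
    Real.log (1 / (2 * δ)) - δ ≤ (1 - 2 * δ) * Real.log ((1 - δ) / δ) := by
  have hlog2 : 0.69 < Real.log 2 ∧ Real.log 2 < 0.7 :=
    ⟨by linarith [Real.log_two_gt_d9], by linarith [Real.log_two_lt_d9]⟩
  -- Multiplied by 2δ, this becomes the tangent line to the convex function 2δ log δ at δ = 1/4.
  have ha : 1 - 1 / (4 * δ) ≤ Real.log (4 * δ) := by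
    simpa using Real.one_sub_inv_le_log_of_pos (show (0 : ℝ) < 4 * δ by linarith)
  have hb : -(δ / (1 - δ)) ≤ Real.log (1 - δ) := by
    have := Real.one_sub_inv_le_log_of_pos (show (0 : ℝ) < 1 - δ by linarith)
    have h : 1 - (1 - δ)⁻¹ = -(δ / (1 - δ)) := by
      have : 1 - δ ≠ 0 := by linarith
      field_simp
      ring
    linarith
  have h4 : Real.log (4 * δ) = 2 * Real.log 2 + Real.log δ := by
    rw [Real.log_mul (by norm_num) h0.ne', show (4 : ℝ) = 2 ^ 2 by norm_num, Real.log_pow]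
    norm_num
  have ha' : 2 * δ * Real.log δ ≥ 2 * δ - 1 / 2 - 4 * δ * Real.log 2 := by
    have : 2 * δ * (1 - 1 / (4 * δ)) ≤ 2 * δ * Real.log (4 * δ) :=
      mul_le_mul_of_nonneg_left ha (by linarith)
    rw [h4] at this
    have h : 2 * δ * (1 - 1 / (4 * δ)) = 2 * δ - 1 / 2 := by field_simp; ring
    linarith
  have hb' : (1 - 2 * δ) * Real.log (1 - δ) ≥ -(δ - δ ^ 2) := by
    have : (1 - 2 * δ) * -(δ / (1 - δ)) ≤ (1 - 2 * δ) * Real.log (1 - δ) :=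
      mul_le_mul_of_nonneg_left hb (by linarith)
    refine le_trans ?_ this
    have h : (1 - 2 * δ) * -(δ / (1 - δ)) = -(δ - δ ^ 2 / (1 - δ)) := by
      have : 1 - δ ≠ 0 := by linarith
      field_simp
      ring
    rw [h]
    have : δ ^ 2 ≤ δ ^ 2 / (1 - δ) := by
      rw [le_div_iff₀ (by linarith)]
      nlinarith [sq_nonneg δ]
    linarith
  have e1 : Real.log (1 / (2 * δ)) = -(Real.log 2 + Real.log δ) := by
    rw [one_div, Real.log_inv, Real.log_mul (by norm_num) h0.ne']
  rw [e1, Real.log_div (by linarith) h0.ne']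
  -- What remains is δ² + 2δ - 1/2 + (1 - 4δ) log 2 ≥ 0; the minimum is at δ = 2 log 2 - 1, whence
  -- the 0.38.
  nlinarith [sq_nonneg (δ - 0.38), hlog2.1, hlog2.2, mul_pos h0 (sub_pos.2 hlog2.2)]

/-- If the models `ν` and `ν'` can be told apart with error probability `δ`, then the expected
number of rounds under `ν` is bounded below in terms of the relative entropies of the arms. -/
theorem log_sub_le_mul_expectedStoppingTime (A : Algorithm K M) {ν ν' : BanditModel K M}
    {φ : Fin K → (Fin M → ℝ) → ℝ} (hφ : ∀ i, Measurable (φ i)) {B D : ℝ} (hD0 : 0 ≤ D)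
    (hB : ∀ i y, |φ i y| ≤ B) (hD : ∀ i, ∫ y, φ i y ∂(ν.law i) ≤ D)
    (hle : ∀ i, (ν.law i).withDensity (fun y => ENNReal.ofReal (Real.exp (-φ i y))) ≤ ν'.law i)
    (S : Set (Option (Fin K))) {δ : ℝ} (hδ : δ ∈ Set.Ioo (0 : ℝ) 1)
    (hP : 1 - δ ≤ (A.outcomeLaw ν).real {ω | ∃ o ∈ S, A.Outputs ω o})
    (hQ : (A.outcomeLaw ν').real {ω | ∃ o ∈ S, A.Outputs ω o} ≤ δ)
    (hT : A.expectedStoppingTime ν ≠ ⊤) :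
    Real.log (1 / (2 * δ)) - δ ≤ D * (A.expectedStoppingTime ν).toReal := by
  have h0 := hδ.1
  have h1 := hδ.2
  rcases le_or_gt (1 / 2) δ with hhalf | hhalf
  · have : Real.log (1 / (2 * δ)) ≤ 0 := by
      refine Real.log_nonpos (by positivity) ?_
      rw [div_le_one (by linarith)]
      linarith
    have : 0 ≤ D * (A.expectedStoppingTime ν).toReal := mul_nonneg hD0 ENNReal.toReal_nonneg
    linarith
  set p := (A.outcomeLaw ν).real {ω | ∃ o ∈ S, A.Outputs ω o}
  set q := (A.outcomeLaw ν').real {ω | ∃ o ∈ S, A.Outputs ω o}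
  -- The likelihood ratios of Bernoulli(1-δ) to Bernoulli(δ), the optimal test values when p = 1 - δ
  -- and q = δ.
  have hα : 0 < (1 - δ) / δ := div_pos (by linarith) h0
  have hβ : 0 < δ / (1 - δ) := div_pos h0 (by linarith)
  have hlim : 1 + p * Real.log ((1 - δ) / δ) + (1 - p) * Real.log (δ / (1 - δ))
      - (1 - δ) / δ * q - δ / (1 - δ) * (1 - q) ≤ D * (A.expectedStoppingTime ν).toReal := by
    have hp := A.tendsto_measureReal_outputEvent S ν
    have hq := A.tendsto_measureReal_outputEvent S ν'
    refine le_of_tendsto ((((tendsto_const_nhds.add (hp.mul_const _)).add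
      ((tendsto_const_nhds.sub hp).mul_const _)).sub (hq.const_mul _)).sub
      ((tendsto_const_nhds.sub hq).const_mul _)) (Filter.Eventually.of_forall fun n => ?_)
    exact (A.log_add_log_sub_le hφ hB hD hle n (A.measurableSet_outputEvent S n)
      (fun ω ω' h => h.mem_outputEvent S) hα hβ).trans
        (mul_le_mul_of_nonneg_left (A.sum_measureReal_active_le ν hT n) hD0)
  refine (log_inv_two_mul_sub_le h0 hhalf).trans (le_trans ?_ hlim)
  have hinv : Real.log (δ / (1 - δ)) = -Real.log ((1 - δ) / δ) := by
    rw [← Real.log_inv, inv_div]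
  have hc : 0 ≤ Real.log ((1 - δ) / δ) := by
    refine Real.log_nonneg ?_
    rw [le_div_iff₀ h0]
    linarith
  have hαβ : δ / (1 - δ) ≤ (1 - δ) / δ := by
    rw [div_le_div_iff₀ (by linarith) h0]
    nlinarith
  have e1 : (1 - δ) / δ * δ = 1 - δ := div_mul_cancel₀ _ h0.ne'
  have e2 : δ / (1 - δ) * (1 - δ) = δ := div_mul_cancel₀ _ (by linarith)
  rw [hinv]
  -- The left side of `hlim` increases with p and decreases with q, and equals (1 - 2δ) log((1 -
  -- δ)/δ) at p = 1 - δ, q = δ.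
  nlinarith [mul_nonneg (sub_nonneg.2 hP) hc, mul_nonneg (sub_nonneg.2 hαβ) (sub_nonneg.2 hQ)]

end Algorithm

/-! ### Likelihood ratios of Bernoulli models. -/

/-- The logarithm of the likelihood ratio of the Bernoulli laws of means `p` and `q`. -/
def bernoulliLogRatio (p q : I) (y : ℝ) : ℝ :=
  if y = 1 then Real.log (p / q) else Real.log ((1 - p) / (1 - q))

/-- The mass that the Bernoulli law of mean `p` gives to `1` (for `true`) or `0` (for `false`). -/
def bernoulliWeight (p : I) (b : Bool) : ℝ≥0∞ := ENNReal.ofReal (if b then p else 1 - p)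

/-- The value `1` or `0`. -/
def boolValue (b : Bool) : ℝ := if b then 1 else 0

lemma bernoulliMeasure_eq_sum (p : I) :
    bernoulliMeasure (1 : ℝ) 0 p =
      ∑ b : Bool, bernoulliWeight p b • Measure.dirac (boolValue b) := by
  rw [bernoulliMeasure_def]
  simp only [Fintype.sum_bool, bernoulliWeight, boolValue, if_true, Bool.false_eq_true, if_false]
  have h1 : ENNReal.ofReal (p : ℝ) = ((unitInterval.toNNReal p : NNReal) : ℝ≥0∞) := by
    rw [ENNReal.ofReal_eq_coe_nnreal p.2.1]; rfl
  have h2 : ENNReal.ofReal (1 - p : ℝ) =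
      ((unitInterval.toNNReal (unitInterval.symm p) : NNReal) : ℝ≥0∞) := by
    rw [ENNReal.ofReal_eq_coe_nnreal (sub_nonneg.2 p.2.2)]; rfl
  rw [h1, h2]; rfl

/-- With finitely many atoms, comparing densities reduces to comparing products of weights. -/
lemma pi_bernoulliMeasure_eq_sum {M : ℕ} (p : Fin M → I) :
    Measure.pi (fun m => bernoulliMeasure (1 : ℝ) 0 (p m)) =
      ∑ v : Fin M → Bool,
        (∏ m, bernoulliWeight (p m) (v m)) • Measure.dirac (fun m => boolValue (v m)) := by
  refine (Measure.pi_eq fun s hs => ?_)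
  have h : ∀ m, bernoulliMeasure (1 : ℝ) 0 (p m) (s m) =
      ∑ b : Bool, bernoulliWeight (p m) b * (s m).indicator 1 (boolValue b) := by
    intro m
    rw [bernoulliMeasure_eq_sum]
    simp [Measure.dirac_apply' _ (hs m)]
  simp only [h]
  rw [Finset.prod_univ_sum, Fintype.piFinset_univ]
  simp only [Measure.coe_finsetSum, Finset.sum_apply, Measure.smul_apply, smul_eq_mul]
  refine Finset.sum_congr rfl fun v _ => ?_
  rw [Finset.prod_mul_distrib, Measure.dirac_apply' _ (MeasurableSet.univ_pi hs)]
  congr 1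
  by_cases hv : ∀ m, boolValue (v m) ∈ s m
  · rw [Set.indicator_of_mem (by simpa using hv)]
    simp [hv]
  · rw [Set.indicator_of_notMem (by simpa using hv)]
    push Not at hv
    obtain ⟨m, hm⟩ := hv
    exact (Finset.prod_eq_zero (Finset.mem_univ m) (by simp [hm])).symm

/-- Equality holds for x > 0. At x = 0 only the inequality survives, which is why the change of
measure is an inequality: means 0 and 1 are allowed under the first model. -/
lemma mul_exp_neg_log_div_le {x y : ℝ} (hx : 0 ≤ x) (hy : 0 ≤ y) (h : x ≠ 0 → y ≠ 0) :
    x * Real.exp (-Real.log (x / y)) ≤ y := by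
  rcases hx.eq_or_lt with rfl | hx
  · simpa using hy
  · have hy : 0 < y := hy.lt_of_ne (h hx.ne').symm
    rw [← Real.log_inv, Real.exp_log (by positivity), inv_div, mul_div_cancel₀ _ hx.ne']

lemma bernoulliWeight_mul_le {p q : I} (h : p = q ∨ (q : ℝ) ∈ Set.Ioo (0 : ℝ) 1) (b : Bool) :
    bernoulliWeight p b * ENNReal.ofReal (Real.exp (-bernoulliLogRatio p q (boolValue b))) ≤
      bernoulliWeight q b := by
  unfold bernoulliWeight
  rw [← ENNReal.ofReal_mul (by have := p.2.1; have := p.2.2; split_ifs <;> linarith)]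
  refine ENNReal.ofReal_le_ofReal ?_
  cases b
  · simp only [Bool.false_eq_true, if_false, bernoulliLogRatio, boolValue, zero_ne_one]
    refine mul_exp_neg_log_div_le (by linarith [p.2.2]) (by linarith [q.2.2]) fun hp => ?_
    rcases h with rfl | h
    · exact hp
    · linarith [h.2]
  · simp only [if_true, bernoulliLogRatio, boolValue]
    refine mul_exp_neg_log_div_le p.2.1 q.2.1 fun hp => ?_
    rcases h with rfl | h
    · exact hp
    · exact h.1.ne'

lemma measurable_bernoulliLogRatio (p q : I) : Measurable (bernoulliLogRatio p q) :=
  Measurable.ite (measurableSet_singleton 1) measurable_const measurable_const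

lemma abs_bernoulliLogRatio_le (p q : I) (y : ℝ) :
    |bernoulliLogRatio p q y| ≤ |Real.log (p / q)| + |Real.log ((1 - p) / (1 - q))| := by
  unfold bernoulliLogRatio
  split_ifs
  · linarith [abs_nonneg (Real.log ((1 - p) / (1 - q) : ℝ))]
  · linarith [abs_nonneg (Real.log (p / q : ℝ))]

namespace BanditModel

variable {K M : ℕ}

lemma integral_eval_bernoulli (p : Fin K → Fin M → I) (i : Fin K) (m : Fin M) {f : ℝ → ℝ}
    (hf : Measurable f) :
    ∫ z, f (z m) ∂((bernoulli p).law i) = p i m * f 1 + (1 - p i m) * f 0 := by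
  have hmp := measurePreserving_eval (fun m => bernoulliMeasure (1 : ℝ) 0 (p i m)) m
  have h := integral_map (μ := (bernoulli p).law i) hmp.measurable.aemeasurable
    (hf.aestronglyMeasurable)
  have h2 : ((bernoulli p).law i).map (Function.eval m) = bernoulliMeasure (1 : ℝ) 0 (p i m) :=
    hmp.map_eq
  rw [h2, integral_bernoulliMeasure] at h
  simpa using h.symm

@[simp]
lemma mean_bernoulli (p : Fin K → Fin M → I) (i : Fin K) (m : Fin M) :
    (bernoulli p).mean i m = p i m := by
  unfold mean
  simpa using integral_eval_bernoulli p i m measurable_id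

/-- The logarithm of the likelihood ratio of two Bernoulli models, for arm `i`. -/
def logRatio (p q : Fin K → Fin M → I) (i : Fin K) (z : Fin M → ℝ) : ℝ :=
  ∑ m, bernoulliLogRatio (p i m) (q i m) (z m)

lemma measurable_logRatio (p q : Fin K → Fin M → I) (i : Fin K) : Measurable (logRatio p q i) :=
  Finset.measurable_sum _ fun m _ =>
    (measurable_bernoulliLogRatio _ _).comp (measurable_pi_apply m)

lemma exists_abs_logRatio_le (p q : Fin K → Fin M → I) :
    ∃ B, ∀ i z, |logRatio p q i z| ≤ B := by
  let c : Fin K → Fin M → ℝ := fun i m =>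
    |Real.log (p i m / q i m)| + |Real.log ((1 - p i m) / (1 - q i m))|
  have hc : ∀ i m, 0 ≤ c i m := fun i m => by positivity
  refine ⟨∑ i, ∑ m, c i m, fun i z => ?_⟩
  calc |logRatio p q i z| ≤ ∑ m, |bernoulliLogRatio (p i m) (q i m) (z m)| :=
        Finset.abs_sum_le_sum_abs _ _
    _ ≤ ∑ m, c i m := Finset.sum_le_sum fun m _ => abs_bernoulliLogRatio_le _ _ _
    _ ≤ ∑ i, ∑ m, c i m := Finset.single_le_sum
        (f := fun i => ∑ m, c i m) (fun i _ => Finset.sum_nonneg fun m _ => hc i m)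
        (Finset.mem_univ i)

/-- Relative entropy is additive over independent coordinates. -/
lemma integral_logRatio (p q : Fin K → Fin M → I) (i : Fin K) :
    ∫ z, logRatio p q i z ∂((bernoulli p).law i) =
      ∑ m, binRelEntropy (p i m) (q i m) := by
  unfold logRatio
  rw [integral_finsetSum]
  · refine Finset.sum_congr rfl fun m _ => ?_
    rw [integral_eval_bernoulli p i m (measurable_bernoulliLogRatio _ _)]
    simp [bernoulliLogRatio, binRelEntropy]
  · intro m _
    exact Integrable.of_bound
      ((measurable_bernoulliLogRatio _ _).comp (measurable_pi_apply m)).aestronglyMeasurable _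
      (ae_of_all _ fun z => abs_bernoulliLogRatio_le _ _ _)

lemma withDensity_logRatio_le {p q : Fin K → Fin M → I}
    (h : ∀ i m, p i m = q i m ∨ (q i m : ℝ) ∈ Set.Ioo (0 : ℝ) 1) (i : Fin K) :
    ((bernoulli p).law i).withDensity
      (fun y => ENNReal.ofReal (Real.exp (-logRatio p q i y))) ≤ (bernoulli q).law i := by
  refine Measure.le_iff.2 fun s hs => ?_
  have hm : Measurable fun y => ENNReal.ofReal (Real.exp (-logRatio p q i y)) :=
    ENNReal.measurable_ofReal.comp (Real.measurable_exp.comp (measurable_logRatio p q i).neg)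
  rw [withDensity_apply _ hs, ← lintegral_indicator hs]
  simp only [bernoulli, pi_bernoulliMeasure_eq_sum, Measure.coe_finsetSum, Finset.sum_apply,
    Measure.smul_apply, smul_eq_mul, lintegral_finsetSum_measure, lintegral_smul_measure,
    lintegral_dirac' _ (hm.indicator hs), Measure.dirac_apply' _ hs]
  refine Finset.sum_le_sum fun v _ => ?_
  by_cases hv : (fun m => boolValue (v m)) ∈ s
  · simp only [Set.indicator_of_mem hv, Pi.one_apply, mul_one, logRatio]
    rw [← Finset.sum_neg_distrib, Real.exp_sum,
      ENNReal.ofReal_prod_of_nonneg fun _ _ => Real.exp_nonneg _, ← Finset.prod_mul_distrib]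
    exact Finset.prod_le_prod' fun m _ => bernoulliWeight_mul_le (h i m) (v m)
  · simp [Set.indicator_of_notMem hv]

end BanditModel

/-! ### Continuity and positivity of the binary relative entropy. -/

lemma binRelEntropy_self (x : ℝ) : binRelEntropy x x = 0 := by
  unfold binRelEntropy
  have h : ∀ y : ℝ, Real.log (y / y) = 0 := fun y => by
    rcases eq_or_ne y 0 with rfl | hy
    · simp
    · simp [div_self hy]
  rw [h, h]; simp

lemma continuousAt_binRelEntropy_right (x : ℝ) {y : ℝ} (hy : y ∈ Set.Ioo (0 : ℝ) 1) :
    ContinuousAt (fun y => binRelEntropy x y) y := by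
  have h : ∀ (x : ℝ) (g : ℝ → ℝ), ContinuousAt g y → g y ≠ 0 →
      ContinuousAt (fun y => x * Real.log (x / g y)) y := by
    intro x g hg hgy
    rcases eq_or_ne x 0 with rfl | hx
    · simpa using continuousAt_const
    · exact continuousAt_const.mul ((continuousAt_const.div hg hgy).log (div_ne_zero hx hgy))
  exact (h x _ continuousAt_id hy.1.ne').add
    (h (1 - x) (fun y => 1 - y) (by fun_prop) (by linarith [hy.2]))

lemma continuousAt_binRelEntropy_left {x y : ℝ} (hx : x ∈ Set.Ioo (0 : ℝ) 1)
    (hy : y ∈ Set.Ioo (0 : ℝ) 1) : ContinuousAt (fun x => binRelEntropy x y) x := by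
  have h0 := hx.1
  have h1 := hx.2
  have h2 := hy.1
  have h3 := hy.2
  unfold binRelEntropy
  have e1 : x / y ≠ 0 := by positivity
  have e2 : (1 - x) / (1 - y) ≠ 0 := div_ne_zero (by linarith) (by linarith)
  fun_prop (disch := assumption)

/-- Each term satisfies x log(x/y) > x - y, and the two linear bounds cancel. -/
lemma binRelEntropy_pos {x y : ℝ} (hx : x ∈ Set.Ioo (0 : ℝ) 1) (hy : y ∈ Set.Ioo (0 : ℝ) 1)
    (hxy : x ≠ y) : 0 < binRelEntropy x y := by
  have h : ∀ x y : ℝ, 0 < x → 0 < y → x ≠ y → x - y < x * Real.log (x / y) := by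
    intro x y hx hy hxy
    have h1 : Real.log (y / x) < y / x - 1 := by
      refine Real.log_lt_sub_one_of_pos (div_pos hy hx) fun h => hxy ?_
      rw [div_eq_one_iff_eq hx.ne'] at h
      exact h.symm
    have h2 : Real.log (y / x) = -Real.log (x / y) := by rw [← Real.log_inv, inv_div]
    have h3 := mul_lt_mul_of_pos_left h1 hx
    rw [h2, mul_sub, mul_div_cancel₀ _ hx.ne'] at h3
    linarith
  have h1 := h x y hx.1 hy.1 hxy
  have h2 := h (1 - x) (1 - y) (by linarith [hx.2]) (by linarith [hy.2]) fun h => hxy (by linarith)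
  unfold binRelEntropy
  linarith

lemma binRelEntropy_one_pos {y : ℝ} (hy : y ∈ Set.Ioo (0 : ℝ) 1) : 0 < binRelEntropy 1 y := by
  unfold binRelEntropy
  have : 0 < Real.log (1 / y) := Real.log_pos ((one_lt_div hy.1).2 hy.2)
  simpa using this

/-! ### Nearby models with a different answer. -/

variable {K M : ℕ}

/-- Moving some of the means of a Bernoulli model to just above (`0 < a`) or just below (`a < 0`)
the thresholds. -/
lemma exists_perturbation (ξ : Fin M → ℝ) (hξ : ∀ m, ξ m ∈ Set.Ioo (0 : ℝ) 1)
    (p : Fin K → Fin M → I) (b : Fin K → Fin M → Prop)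
    [∀ i m, Decidable (b i m)]
    (hb : ∀ i m, ¬ b i m → (p i m : ℝ) ≠ ξ m) {a : ℝ} (ha : a ≠ 0) {ε : ℝ} (hε : 0 < ε) :
    ∃ (q : Fin K → Fin M → I) (η : ℝ), 0 < η ∧
      (∀ i m, (q i m : ℝ) = if b i m then ξ m + a * η else p i m) ∧
      (∀ i m, (q i m : ℝ) ≠ ξ m) ∧
      (∀ i m, p i m = q i m ∨ (q i m : ℝ) ∈ Set.Ioo (0 : ℝ) 1) ∧
      ∀ i, ∑ m, binRelEntropy (p i m) (q i m) ≤
        ∑ m, (if b i m then binRelEntropy (p i m) (ξ m) else 0) + ε := by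
  have hlin : ∀ m, Filter.Tendsto (fun η : ℝ => ξ m + a * η) (nhdsWithin 0 (Set.Ioi 0))
      (nhds (ξ m)) := by
    intro m
    have : Filter.Tendsto (fun η : ℝ => ξ m + a * η) (nhds 0) (nhds (ξ m + a * 0)) :=
      Continuous.tendsto (by fun_prop) 0
    rw [mul_zero, add_zero] at this
    exact this.mono_left nhdsWithin_le_nhds
  have h1 : ∀ᶠ η : ℝ in nhdsWithin 0 (Set.Ioi 0), ∀ m, ξ m + a * η ∈ Set.Ioo (0 : ℝ) 1 :=
    Filter.eventually_all.2 fun m => (hlin m).eventually (isOpen_Ioo.mem_nhds (hξ m))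
  have h2 : ∀ᶠ η : ℝ in nhdsWithin 0 (Set.Ioi 0), ∀ i,
      ∑ m, (if b i m then binRelEntropy (p i m) (ξ m + a * η) else 0) <
        ∑ m, (if b i m then binRelEntropy (p i m) (ξ m) else 0) + ε := by
    refine Filter.eventually_all.2 fun i => ?_
    have ht : Filter.Tendsto
        (fun η => ∑ m, (if b i m then binRelEntropy (p i m) (ξ m + a * η) else 0))
        (nhdsWithin 0 (Set.Ioi 0))
        (nhds (∑ m, (if b i m then binRelEntropy (p i m) (ξ m) else 0))) := by
      refine tendsto_finsetSum _ fun m _ => ?_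
      split_ifs
      · exact (continuousAt_binRelEntropy_right _ (hξ m)).tendsto.comp (hlin m)
      · exact tendsto_const_nhds
    exact ht.eventually_lt_const (by linarith)
  obtain ⟨η, ⟨h1, h2⟩, hη⟩ := ((h1.and h2).and self_mem_nhdsWithin).exists
  have hη : 0 < η := hη
  have hI : ∀ i m, (if b i m then ξ m + a * η else (p i m : ℝ)) ∈ Set.Icc (0 : ℝ) 1 := by
    intro i m
    split_ifs
    · exact Set.Ioo_subset_Icc_self (h1 m)
    · exact (p i m).2
  refine ⟨fun i m => ⟨_, hI i m⟩, η, hη, fun i m => rfl, fun i m => ?_, fun i m => ?_,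
    fun i => ?_⟩
  · by_cases h : b i m
    · simp [h, ha, hη.ne']
    · simpa [h] using hb i m h
  · by_cases h : b i m
    · exact Or.inr (by simpa [h] using h1 m)
    · exact Or.inl (Subtype.ext (by simp [h]))
  · refine le_trans (Finset.sum_le_sum fun m _ => ?_) (h2 i).le
    by_cases h : b i m
    · simp [h]
    · simp [h, binRelEntropy_self]

namespace Algorithm

lemma Outputs.unique {A : Algorithm K M} {ω : A.Outcome} {o o' : Option (Fin K)}
    (h : A.Outputs ω o) (h' : A.Outputs ω o') : o = o' := by
  obtain ⟨t, ht, rfl⟩ := h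
  obtain ⟨t', ht', rfl⟩ := h'
  obtain rfl : t = t' := by exact_mod_cast ht.symm.trans ht'
  rfl

/-- Only an inequality, since the algorithm may never stop. -/
lemma measureReal_outputs_le_of_compl (A : Algorithm K M) (ν : BanditModel K M)
    (S : Set (Option (Fin K))) {δ : ℝ}
    (h : 1 - δ ≤ (A.outcomeLaw ν).real {ω | ∃ o ∈ Sᶜ, A.Outputs ω o}) :
    (A.outcomeLaw ν).real {ω | ∃ o ∈ S, A.Outputs ω o} ≤ δ := by
  have hdisj : Disjoint {ω | ∃ o ∈ S, A.Outputs ω o} {ω | ∃ o ∈ Sᶜ, A.Outputs ω o} := by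
    refine Set.disjoint_left.2 ?_
    rintro ω ⟨o, ho, h⟩ ⟨o', ho', h'⟩
    exact ho' (h.unique h' ▸ ho)
  have h1 := measureReal_union (μ := A.outcomeLaw ν) hdisj (A.measurableSet_outputs Sᶜ)
  have h2 : (A.outcomeLaw ν).real
    ({ω | ∃ o ∈ S, A.Outputs ω o} ∪ {ω | ∃ o ∈ Sᶜ, A.Outputs ω o}) ≤ 1 := measureReal_le_one
  linarith

/-- The lower bound for a Bernoulli model from nearby Bernoulli models with a different answer. -/
theorem div_le_expectedStoppingTime (A : Algorithm K M) (p : Fin K → Fin M → I) (R : ℝ≥0∞)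
    (S : Set (Option (Fin K))) {δ : ℝ} (hδ : δ ∈ Set.Ioo (0 : ℝ) 1)
    (hP : 1 - δ ≤
      (A.outcomeLaw (BanditModel.bernoulli p)).real {ω | ∃ o ∈ S, A.Outputs ω o})
    (hQ : R ≠ ⊤ → ∀ ε > 0, ∃ q : Fin K → Fin M → I,
      (∀ i m, p i m = q i m ∨ (q i m : ℝ) ∈ Set.Ioo (0 : ℝ) 1) ∧
      (∀ i, ∑ m, binRelEntropy (p i m) (q i m) ≤ R.toReal + ε) ∧
      1 - δ ≤ (A.outcomeLaw (BanditModel.bernoulli q)).real {ω | ∃ o ∈ Sᶜ, A.Outputs ω o}) :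
    ENNReal.ofReal (Real.log (1 / (2 * δ)) - δ) / R ≤
      A.expectedStoppingTime (BanditModel.bernoulli p) := by
  rcases eq_or_ne R ⊤ with hR | hR
  · simp [hR]
  rcases eq_or_ne (A.expectedStoppingTime (BanditModel.bernoulli p)) ⊤ with hT | hT
  · simp [hT]
  -- This covers `R = 0` too: the product bound then forces the numerator to vanish, and 0 / 0 = 0.
  refine ENNReal.div_le_of_le_mul ?_
  refine ENNReal.ofReal_le_of_le_toReal ?_
  rw [ENNReal.toReal_mul, mul_comm _ R.toReal]
  set τ := (A.expectedStoppingTime (BanditModel.bernoulli p)).toReal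
  have hbound : ∀ ε > 0, Real.log (1 / (2 * δ)) - δ ≤ (R.toReal + ε) * τ := by
    intro ε hε
    obtain ⟨q, hpq, hD, hq⟩ := hQ hR ε hε
    obtain ⟨B, hB⟩ := BanditModel.exists_abs_logRatio_le p q
    exact A.log_sub_le_mul_expectedStoppingTime (BanditModel.measurable_logRatio p q)
      (add_nonneg ENNReal.toReal_nonneg hε.le) hB
      (fun i => (BanditModel.integral_logRatio p q i).trans_le (hD i))
      (BanditModel.withDensity_logRatio_le hpq) S hδ hP
      (A.measureReal_outputs_le_of_compl _ S hq) hT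
  have hlim : Filter.Tendsto (fun ε : ℝ => (R.toReal + ε) * τ) (nhdsWithin 0 (Set.Ioi 0))
      (nhds (R.toReal * τ)) := by
    have : Filter.Tendsto (fun ε : ℝ => (R.toReal + ε) * τ) (nhds 0)
        (nhds ((R.toReal + 0) * τ)) := Continuous.tendsto (by fun_prop) 0
    rw [add_zero] at this
    exact this.mono_left nhdsWithin_le_nhds
  exact ge_of_tendsto hlim (Filter.eventually_of_mem self_mem_nhdsWithin hbound)

lemma IsSuccessful.some_of_good {A : Algorithm K M} {C : Set (BanditModel K M)} {ξ : Fin M → ℝ}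
    {δ : ℝ} (h : A.IsSuccessful C ξ δ 0) {ν : BanditModel K M} (hν : ν ∈ C)
    (hg : ∃ i, ν.IsGood ξ 0 i) :
    1 - δ ≤ (A.outcomeLaw ν).real {ω | ∃ o ∈ ({none}ᶜ : Set (Option (Fin K))), A.Outputs ω o} := by
  refine ((h ν hν).1 hg).trans (measureReal_mono ?_)
  rintro ω ⟨i, ho, -⟩
  exact ⟨some i, by simp, ho⟩

lemma IsSuccessful.none_of_not_good {A : Algorithm K M} {C : Set (BanditModel K M)}
    {ξ : Fin M → ℝ} {δ : ℝ} (h : A.IsSuccessful C ξ δ 0) {ν : BanditModel K M} (hν : ν ∈ C)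
    (hg : ¬ ∃ i, ν.IsGood ξ 0 i) :
    1 - δ ≤ (A.outcomeLaw ν).real {ω | ∃ o ∈ ({none} : Set (Option (Fin K))), A.Outputs ω o} := by
  refine ((h ν hν).2 hg).trans (measureReal_mono ?_)
  intro ω ho
  exact ⟨none, rfl, ho⟩

end Algorithm

/-! ### The two lower bounds. -/

/-- The lower bound for models with a good arm. -/
theorem good_lower_bound (hM : 0 < M) (ξ : Fin M → ℝ) (hξ : ∀ m, ξ m ∈ Set.Ioo (0 : ℝ) 1)
    (p : Fin K → Fin M → I) (C : Set (BanditModel K M)) (δ : ℝ) (A : Algorithm K M)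
    (hgood : ∃ i, (BanditModel.bernoulli p).IsGood ξ 0 i)
    (hC : BanditModel.nondegenerateBernoulli K ξ ⊆ C) (hp : BanditModel.bernoulli p ∈ C)
    (hδ : δ ∈ Set.Ioo (0 : ℝ) 1) (hA : A.IsSuccessful C ξ δ 0) :
    ENNReal.ofReal (Real.log (1 / (2 * δ)) - δ) /
        (BanditModel.bernoulli p).maxMinEntropy ξ {i | (BanditModel.bernoulli p).IsGood ξ 0 i}
      ≤ A.expectedStoppingTime (BanditModel.bernoulli p) := by
  classical
  have : Nonempty (Fin M) := ⟨⟨0, hM⟩⟩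
  refine A.div_le_expectedStoppingTime p _ {none}ᶜ hδ (hA.some_of_good hp hgood)
    fun hR ε hε => ?_
  set G : Fin K → Prop := fun i => (BanditModel.bernoulli p).IsGood ξ 0 i with hG
  set R := (BanditModel.bernoulli p).maxMinEntropy ξ {i | G i} with hRdef
  have hmin : ∀ i, ∃ m₀, ∀ m, binRelEntropy (p i m₀) (ξ m₀) ≤ binRelEntropy (p i m) (ξ m) :=
    fun i => Finite.exists_min fun m => binRelEntropy (p i m) (ξ m)
  choose μ hμ using hmin
  have hle : ∀ i, G i → binRelEntropy (p i (μ i)) (ξ (μ i)) ≤ R.toReal := by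
    intro i hi
    refine (ENNReal.ofReal_le_iff_le_toReal hR).1 ?_
    refine le_trans ?_ (le_iSup₂ (f := fun i (_ : i ∈ {i | G i}) => ⨅ m, ENNReal.ofReal
      (binRelEntropy ((BanditModel.bernoulli p).mean i m) (ξ m))) i hi)
    refine le_iInf fun m => ENNReal.ofReal_le_ofReal ?_
    rw [BanditModel.mean_bernoulli]
    exact hμ i m
  -- Means equal to their thresholds are lowered as well, so that `q` is nondegenerate; since d(ξ,
  -- ξ) = 0, they add nothing to the limiting cost.
  obtain ⟨q, η, hη, hq, hqne, hpq, hsum⟩ := exists_perturbation ξ hξ p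
    (fun i m => (G i ∧ m = μ i) ∨ (p i m : ℝ) = ξ m)
    (fun i m h => fun h' => h (Or.inr h')) (a := -1) (by norm_num) hε
  refine ⟨q, hpq, fun i => (hsum i).trans ?_, ?_⟩
  · gcongr
    calc ∑ m, (if (G i ∧ m = μ i) ∨ (p i m : ℝ) = ξ m then binRelEntropy (p i m) (ξ m) else 0)
        = ∑ m, (if m = μ i then (if G i then binRelEntropy (p i m) (ξ m) else 0) else 0) := by
          refine Finset.sum_congr rfl fun m _ => ?_
          by_cases he : (p i m : ℝ) = ξ m
          · simp [he, binRelEntropy_self]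
          · by_cases hm : m = μ i
            · subst hm
              simp [he]
            · simp [he, hm]
      _ = if G i then binRelEntropy (p i (μ i)) (ξ (μ i)) else 0 := by simp
      _ ≤ R.toReal := by
          split_ifs with h
          · exact hle i h
          · exact ENNReal.toReal_nonneg
  · rw [compl_compl]
    refine hA.none_of_not_good (hC ⟨q, hqne, rfl⟩) ?_
    rintro ⟨i, hi⟩
    simp only [BanditModel.IsGood, BanditModel.mean_bernoulli, sub_zero] at hi
    by_cases hGi : G i
    · have h := hi (μ i)
      rw [hq, if_pos (Or.inl ⟨hGi, rfl⟩)] at h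
      linarith
    -- An arm that was not good has a mean strictly below its threshold, and that mean has not been
    -- moved.
    · have hGi' := hGi
      simp only [hG, BanditModel.IsGood, BanditModel.mean_bernoulli, sub_zero] at hGi'
      push Not at hGi'
      obtain ⟨m, hm⟩ := hGi'
      have h := hi m
      rw [hq, if_neg (by rintro (⟨h, -⟩ | h); exacts [hGi h, hm.ne h])] at h
      linarith

/-- A model without a good arm for which the lower bound holds. -/
theorem exists_bad_lower_bound (hK : 0 < K) (hM : 0 < M) (ξ : Fin M → ℝ)
    (hξ : ∀ m, ξ m ∈ Set.Ioo (0 : ℝ) 1) (c : ℝ) (hc : 0 < c) :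
    ∃ p : Fin K → Fin M → I,
      (∀ i m, (p i m : ℝ) ≠ ξ m) ∧
      (¬ ∃ i, (BanditModel.bernoulli p).IsGood ξ 0 i) ∧
      0 < (BanditModel.bernoulli p).maxMinEntropy ξ Set.univ ∧
      (BanditModel.bernoulli p).maxMinEntropy ξ Set.univ ≤ ENNReal.ofReal c ∧
      ∀ (C : Set (BanditModel K M)) (δ : ℝ) (A : Algorithm K M),
        BanditModel.nondegenerateBernoulli K ξ ⊆ C →
        δ ∈ Set.Ioo (0 : ℝ) 1 →
        A.IsSuccessful C ξ δ 0 →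
        ENNReal.ofReal (Real.log (1 / (2 * δ)) - δ) /
            (BanditModel.bernoulli p).maxMinEntropy ξ Set.univ
          ≤ A.expectedStoppingTime (BanditModel.bernoulli p) := by
  classical
  set i₀ : Fin K := ⟨0, hK⟩
  set m₀ : Fin M := ⟨0, hM⟩
  -- As x tends to `ξ m₀` from below, its entropy tends to 0, hence falls below `c` and below the
  -- positive entropies of the coordinates with mean 1.
  obtain ⟨x, hx0, hxξ, hxc, hxm⟩ : ∃ x, 0 < x ∧ x < ξ m₀ ∧ binRelEntropy x (ξ m₀) < c ∧
      ∀ m, binRelEntropy x (ξ m₀) < binRelEntropy 1 (ξ m) := by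
    have ht := (continuousAt_binRelEntropy_left (hξ m₀) (hξ m₀)).tendsto
    simp only [binRelEntropy_self] at ht
    have ht' := ht.mono_left (nhdsWithin_le_nhds (s := Set.Iio (ξ m₀)))
    have h1 := ht'.eventually_lt_const hc
    have h2 := Filter.eventually_all.2 fun m =>
      ht'.eventually_lt_const (binRelEntropy_one_pos (hξ m))
    have h3 : ∀ᶠ x in nhdsWithin (ξ m₀) (Set.Iio (ξ m₀)), 0 < x :=
      nhdsWithin_le_nhds (lt_mem_nhds (hξ m₀).1)
    obtain ⟨x, ⟨⟨h1, h2⟩, h3⟩, h4⟩ := (((h1.and h2).and h3).and self_mem_nhdsWithin).exists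
    exact ⟨x, h3, h4, h1, h2⟩
  have hx1 : x < 1 := hxξ.trans (hξ m₀).2
  have hpos : 0 < binRelEntropy x (ξ m₀) := binRelEntropy_pos ⟨hx0, hx1⟩ (hξ m₀) hxξ.ne
  obtain ⟨p, hp0, hp1⟩ : ∃ p : Fin K → Fin M → I, (∀ i, (p i m₀ : ℝ) = x) ∧
      ∀ i m, m ≠ m₀ → (p i m : ℝ) = 1 :=
    ⟨fun _ m => if m = m₀ then ⟨x, hx0.le, hx1.le⟩ else 1, fun i => by simp,
      fun i m hm => by simp [hm]⟩
  have hmax : (BanditModel.bernoulli p).maxMinEntropy ξ Set.univ =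
      ENNReal.ofReal (binRelEntropy x (ξ m₀)) := by
    have hinf : ∀ i, ⨅ m, ENNReal.ofReal
        (binRelEntropy ((BanditModel.bernoulli p).mean i m) (ξ m)) =
        ENNReal.ofReal (binRelEntropy x (ξ m₀)) := by
      intro i
      simp only [BanditModel.mean_bernoulli]
      refine le_antisymm ((iInf_le _ m₀).trans_eq (by rw [hp0])) (le_iInf fun m => ?_)
      refine ENNReal.ofReal_le_ofReal ?_
      by_cases hm : m = m₀
      · rw [hm, hp0]
      · rw [hp1 i m hm]
        exact (hxm m).le
    have : Nonempty (Fin K) := ⟨i₀⟩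
    simp only [BanditModel.maxMinEntropy, hinf]
    simp
  have hne : ∀ i m, (p i m : ℝ) ≠ ξ m := by
    intro i m
    by_cases hm : m = m₀
    · rw [hm, hp0]
      exact hxξ.ne
    · rw [hp1 i m hm]
      exact (hξ m).2.ne'
  have hbad : ¬ ∃ i, (BanditModel.bernoulli p).IsGood ξ 0 i := by
    rintro ⟨i, hi⟩
    have h := hi m₀
    rw [BanditModel.mean_bernoulli, hp0] at h
    linarith
  refine ⟨p, hne, hbad, ?_, ?_, fun C δ A hC hδ hA => ?_⟩
  · rw [hmax]
    exact ENNReal.ofReal_pos.2 hpos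
  · rw [hmax]
    exact ENNReal.ofReal_le_ofReal hxc.le
  refine A.div_le_expectedStoppingTime p _ {none} hδ
    (hA.none_of_not_good (hC ⟨p, hne, rfl⟩) hbad) fun _ ε hε => ?_
  -- Raising a single mean of the arm `i₀` makes that arm good, as its other means are 1.
  obtain ⟨q, η, hη, hq, hqne, hpq, hsum⟩ := exists_perturbation ξ hξ p
    (fun i m => i = i₀ ∧ m = m₀) (fun i m _ => hne i m) (a := 1) one_ne_zero hε
  refine ⟨q, hpq, fun i => (hsum i).trans ?_, hA.some_of_good (hC ⟨q, hqne, rfl⟩) ⟨i₀, fun m => ?_⟩⟩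
  · rw [hmax, ENNReal.toReal_ofReal hpos.le]
    gcongr
    by_cases hi : i = i₀
    · simp [hi, hp0]
    · simpa [hi] using hpos.le
  · rw [BanditModel.mean_bernoulli, hq]
    by_cases hm : m = m₀
    · rw [if_pos ⟨rfl, hm⟩]
      linarith
    · rw [if_neg fun h => hm h.2, hp1 _ m hm]
      linarith [(hξ m).2]

end MTGAI
end

theorem mainTheorem6 (K M : ℕ) (hK : 0 < K) (hM : 0 < M) (ξ : Fin M → ℝ)
    (hξ : ∀ m, ξ m ∈ Set.Ioo (0 : ℝ) 1) :
    -- Every Bernoulli model with a good arm.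
    (∀ (p : Fin K → Fin M → unitInterval) (C : Set (MTGAI.BanditModel K M)) (δ : ℝ)
        (A : MTGAI.Algorithm K M),
      (∃ i, (MTGAI.BanditModel.bernoulli p).IsGood ξ 0 i) →
      MTGAI.BanditModel.nondegenerateBernoulli K ξ ⊆ C →
      MTGAI.BanditModel.bernoulli p ∈ C →
      δ ∈ Set.Ioo (0 : ℝ) 1 →
      A.IsSuccessful C ξ δ 0 →
      ENNReal.ofReal (Real.log (1 / (2 * δ)) - δ) /
          (MTGAI.BanditModel.bernoulli p).maxMinEntropy ξ
            {i | (MTGAI.BanditModel.bernoulli p).IsGood ξ 0 i}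
        ≤ A.expectedStoppingTime (MTGAI.BanditModel.bernoulli p)) ∧
    -- Some nondegenerate Bernoulli model without a good arm, with an arbitrarily small denominator.
    (∀ c : ℝ, 0 < c → ∃ p : Fin K → Fin M → unitInterval,
      (∀ i m, (p i m : ℝ) ≠ ξ m) ∧
      (¬ ∃ i, (MTGAI.BanditModel.bernoulli p).IsGood ξ 0 i) ∧
      0 < (MTGAI.BanditModel.bernoulli p).maxMinEntropy ξ Set.univ ∧
      (MTGAI.BanditModel.bernoulli p).maxMinEntropy ξ Set.univ ≤ ENNReal.ofReal c ∧
      ∀ (C : Set (MTGAI.BanditModel K M)) (δ : ℝ) (A : MTGAI.Algorithm K M),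
        MTGAI.BanditModel.nondegenerateBernoulli K ξ ⊆ C →
        δ ∈ Set.Ioo (0 : ℝ) 1 →
        A.IsSuccessful C ξ δ 0 →
        ENNReal.ofReal (Real.log (1 / (2 * δ)) - δ) /
            (MTGAI.BanditModel.bernoulli p).maxMinEntropy ξ Set.univ
          ≤ A.expectedStoppingTime (MTGAI.BanditModel.bernoulli p)) := by
  exact ⟨fun p C δ A hgood hC hp hδ hA =>
      MTGAI.good_lower_bound hM ξ hξ p C δ A hgood hC hp hδ hA,
    fun c hc => MTGAI.exists_bad_lower_bound hK hM ξ hξ c hc⟩
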